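/- Let $b,c\in C[0,1]$ and $\lambda,a_1,a_2,a_3,a_4\in C([0,1]^2)$ be non-negative and let $\phi\in C[0,1]$. For $N\ge 1$ let $(X^N_t)_{t\ge 0}$ be the continuous-time Markov process on $[0,\infty)^N$ with generator $$\mathcal L_Nf(x)=\sum_{i=1}^N b\left(\tfrac iN\right)\big(f(x^{i,+})-f(x)\big)+\frac1N\sum_{i=1}^N\sum_{j\ne i}\lambda\left(\tfrac iN,\tfrac jN\right)\big(f(x^{(i,j)})-f(x)\big),$$ where $x^{i,+}$ is obtained from $x$ by replacing $x(i)$ by $c(\frac iN)x(i)$, and $x^{(i,j)}$ is obtained from $x$ by replacing $x(i)$ by $a_1x(i)+a_2x(j)$ and $x(j)$ by $a_3x(i)+a_4x(j)$, with $a_1,\dots,a_4$ evaluated at $(\frac iN,\frac jN)$. Assume that $X^N_0(1),\dots,X^N_0(N)$ are independent with $P(X^N_0(i)=1)=\phi(\frac iN)=1-P(X^N_0(i)=0)$ for each $i$. Equip $C[0,1]$ with the supremum norm and its dual $(C[0,1])'$ with the dual norm. Let $\rho:[0,\infty)\to C[0,1]$ be the unique solution of $\rho(0,\cdot)=\phi$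 and $$\frac{d}{dt}\rho(t,u)=\Big(b(u)(c(u)-1)+\int_0^1\lambda(v,u)(a_4(v,u)-1)dv+\int_0^1\lambda(u,v)(a_1(u,v)-1)dv\Big)\rho(t,u)+\int_0^1\big(\lambda(u,v)a_2(u,v)+\lambda(v,u)a_3(v,u)\big)\rho(t,v)dv$$ (as an ordinary differential equation in $C[0,1]$). For $f\in C[0,1]$ put $$P_2f(u)=(c^2(u)-1)b(u)f(u)+f(u)\int_0^1\lambda(u,v)(a_1^2(u,v)-1)dv+\int_0^1\lambda(v,u)a_2^2(v,u)f(v)dv+\int_0^1\lambda(u,v)a_3^2(u,v)f(v)dv+f(u)\int_0^1\lambda(v,u)(a_4^2(v,u)-1)dv,$$ $$l_{1,t}(f)=2\int_0^1\!\!\int_0^1\rho(t,u)\rho(t,v)\big(a_1(u,v)a_2(u,v)\lambda(u,v)+\lambda(v,u)a_3(v,u)a_4(v,u)\big)f(u)\,du\,dv,$$ and let $P_2^*$ be the adjoint of $P_2$, $(P_2^*\nu)(f)=\nu(P_2f)$ for $\nu\in(C[0,1])'$. Let $T>0$. Then the $(C[0,1])'$-valued ordinary differential equation $$\frac{d}{dt}\theta_t=P_2^*\theta_t+l_{1,t}\quad(0\le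 t\le T),\qquad \theta_0(du)=\phi(u)\,du,$$ has a unique solution $(\theta_t)_{0\le t\le T}$, and, with $\theta^N_t=\frac1N\sum_{i=1}^N(X^N_t(i))^2\delta_{i/N}$, $$\lim_{N\to\infty}\ \sup_{0\le t\le T}\mathbb E\Big(\big(\theta^N_t(H_t)-\theta_t(H_t)\big)^2\Big)=0\qquad\text{for every }H\in C([0,T]\times[0,1]),$$ where $H_t=H(t,\cdot)$. Furthermore, there exists $\vartheta\in C([0,T]\times[0,1])$ such that $\theta_t(du)=\vartheta(t,u)\,du$ for all $0\le t\le T$. -/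

import Mathlib

open MeasureTheory ProbabilityTheory Filter Topology unitInterval
open scoped NNReal ENNReal BoundedContinuousFunction

noncomputable section

namespace NUrn

/-- The parameters of the model: `b, c ∈ C[0,1]` and `λ, a₁, a₂, a₃, a₄ ∈ C([0,1] × [0,1])`,
all of them non-negative. -/
structure Coeffs where
  b : C(I, ℝ≥0)
  c : C(I, ℝ≥0)
  lam : C(I × I, ℝ≥0)
  a₁ : C(I × I, ℝ≥0)
  a₂ : C(I × I, ℝ≥0)
  a₃ : C(I × I, ℝ≥0)
  a₄ : C(I × I, ℝ≥0)

/-- A non-negative continuous function, seen as a real-valued one. -/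
def toR {Y : Type*} [TopologicalSpace Y] (g : C(Y, ℝ≥0)) : C(Y, ℝ) :=
  ⟨fun y => (g y : ℝ), by fun_prop⟩

/-! ### The process -/

/-- The state space `[0, ∞)^N`. The urn called `i` in the usual numbering `1, …, N` is the index
`i - 1 : Fin N`. -/
abbrev State (N : ℕ) : Type := Fin N → ℝ≥0

/-- The position `i / N ∈ [0,1]` of the `i`-th urn (`i = 1, …, N`). -/
def pos {N : ℕ} (i : Fin N) : I :=
  ⟨((i : ℝ) + 1) / N, by
    have hi : (i : ℝ) + 1 ≤ N := by exact_mod_cast i.isLt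
    constructor
    · positivity
    · exact div_le_one_of_le₀ hi (by positivity)⟩

/-- The state `x^{i,+}`: the `i`-th coordinate of `x` is multiplied by `c(i/N)`. -/
def jumpSite (M : Coeffs) {N : ℕ} (i : Fin N) (x : State N) : State N :=
  fun k => if k = i then M.c (pos i) * x i else x k

/-- The state `x^{(i,j)}`: the pair `(x(i), x(j))` undergoes the linear transformation with
entries `a₁, a₂, a₃, a₄` at `(i/N, j/N)`. -/
def jumpPair (M : Coeffs) {N : ℕ} (i j : Fin N) (x : State N) : State N :=
  fun k =>
    if k = i then M.a₁ (pos i, pos j) * x i + M.a₂ (pos i, pos j) * x j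
    else if k = j then M.a₃ (pos i, pos j) * x i + M.a₄ (pos i, pos j) * x j
    else x k

theorem continuous_jumpSite (M : Coeffs) {N : ℕ} (i : Fin N) :
    Continuous (jumpSite M i : State N → State N) := by
  refine continuous_pi fun k => ?_
  unfold jumpSite
  split_ifs <;> fun_prop

theorem continuous_jumpPair (M : Coeffs) {N : ℕ} (i j : Fin N) :
    Continuous (jumpPair M i j : State N → State N) := by
  refine continuous_pi fun k => ?_
  unfold jumpPair
  split_ifs <;> fun_prop

/-- Composition `f ↦ f ∘ g` as a bounded operator on bounded continuous functions. -/
def pullback {Y : Type*} [TopologicalSpace Y] (g : C(Y, Y)) : (Y →ᵇ ℝ) →L[ℝ] (Y →ᵇ ℝ) where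
  toFun f := f.compContinuous g
  map_add' _ _ := rfl
  map_smul' _ _ := rfl
  cont := BoundedContinuousFunction.continuous_compContinuous g

/-- The generator of the `N`-urn linear system. Since the total jump rate is bounded, it is
a bounded operator on the bounded continuous functions on `[0, ∞)^N`; see `generator_apply`. -/
def generator (M : Coeffs) (N : ℕ) : (State N →ᵇ ℝ) →L[ℝ] (State N →ᵇ ℝ) :=
  (∑ i : Fin N, (M.b (pos i) : ℝ) • (pullback ⟨jumpSite M i, continuous_jumpSite M i⟩ - 1)) +
    (1 / N : ℝ) • ∑ i : Fin N, ∑ j ∈ Finset.univ.filter (fun j => j ≠ i),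
      (M.lam (pos i, pos j) : ℝ) • (pullback ⟨jumpPair M i j, continuous_jumpPair M i j⟩ - 1)

theorem generator_apply (M : Coeffs) (N : ℕ) (f : State N →ᵇ ℝ) (x : State N) :
    generator M N f x =
      ∑ i : Fin N, (M.b (pos i) : ℝ) * (f (jumpSite M i x) - f x) +
      (1 / N : ℝ) * ∑ i : Fin N, ∑ j ∈ Finset.univ.filter (fun j => j ≠ i),
        (M.lam (pos i, pos j) : ℝ) * (f (jumpPair M i j x) - f x) := by
  have h : ∀ g : C(State N, State N), pullback g f x = f (g x) := fun _ => rfl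
  simp [generator, h, BoundedContinuousFunction.coe_sum]


/-- The exponential `exp A = ∑ Aⁿ / n!` of a bounded operator `A` on a Banach space. -/
def opExp {E : Type*} [NormedAddCommGroup E] [NormedSpace ℝ E] (A : E →L[ℝ] E) : E →L[ℝ] E :=
  NormedSpace.exp A

/-- The transition semigroup `S(t) = exp(t L)` of the Markov process with generator `L`. -/
def semigroup (M : Coeffs) (N : ℕ) (t : ℝ≥0) : (State N →ᵇ ℝ) →L[ℝ] (State N →ᵇ ℝ) :=
  opExp ((t : ℝ) • generator M N)

/-- The `σ`-algebra generated by `X r`, `r ≤ s`. -/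
@[reducible]
def past {Ω E : Type*} [MeasurableSpace E] (X : ℝ≥0 → Ω → E) (s : ℝ≥0) : MeasurableSpace Ω :=
  ⨆ r : Set.Iic s, MeasurableSpace.comap (X r) inferInstance

/-- `X` is (a version of) the `N`-urn linear system under the probability measure `P`: a process
with càdlàg paths which is Markov with the transition semigroup generated by `generator M N`. -/
structure IsLinearSystem (M : Coeffs) (N : ℕ) {Ω : Type*} [MeasurableSpace Ω] (P : Measure Ω)
    (X : ℝ≥0 → Ω → State N) : Prop where
  measurable : ∀ t, Measurable (X t)
  cadlag : ∀ᵐ ω ∂P, ∀ t, ContinuousWithinAt (fun s => X s ω) (Set.Ici t) t ∧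
    ∃ l, Tendsto (fun s => X s ω) (𝓝[<] t) (𝓝 l)
  markov : ∀ (s t : ℝ≥0) (f : State N →ᵇ ℝ),
    P[fun ω => f (X (s + t) ω) | past X s] =ᵐ[P] fun ω => semigroup M N t f (X s ω)

/-- The initial state: independent coordinates, the `i`-th being `1` with probability `φ(i/N)` and
`0` with probability `1 - φ(i/N)`. (So `0 ≤ φ(i/N) ≤ 1` necessarily.) -/
structure IsInitialState (φ : C(I, ℝ)) (N : ℕ) {Ω : Type*} [MeasurableSpace Ω] (P : Measure Ω)
    (X₀ : Ω → State N) : Prop where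
  indep : iIndepFun (fun (i : Fin N) ω => X₀ ω i) P
  prob_one : ∀ i : Fin N, P.real {ω | X₀ ω i = 1} = φ (pos i)
  prob_zero : ∀ i : Fin N, P.real {ω | X₀ ω i = 0} = 1 - φ (pos i)

/-- `θ^N = (1/N) ∑ᵢ x(i)² δ_{i/N}` for a state `x`, as an element of the dual of `C[0,1]`. -/
def sqEmpirical {N : ℕ} (x : State N) : StrongDual ℝ C(I, ℝ) :=
  (1 / N : ℝ) • ∑ i : Fin N, ((x i : ℝ) ^ 2) • ContinuousMap.evalCLM ℝ (pos i)

theorem sqEmpirical_apply {N : ℕ} (x : State N) (f : C(I, ℝ)) :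
    sqEmpirical x f = (1 / N : ℝ) * ∑ i : Fin N, (x i : ℝ) ^ 2 * f (pos i) := by
  simp [sqEmpirical, ContinuousMap.evalCLM]

/-! ### The limiting equations -/

theorem integrable_C (f : C(I, ℝ)) : Integrable f (volume : Measure I) :=
  f.continuous.integrable_of_hasCompactSupport (HasCompactSupport.of_compactSpace f)

theorem abs_integral_C_le (f : C(I, ℝ)) : |∫ v, f v| ≤ ‖f‖ := by
  have h := norm_integral_le_of_norm_le_const (μ := (volume : Measure I))
    (Eventually.of_forall fun v => f.norm_coe_le_norm v)
  simpa using h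

/-- The functional `f ↦ ∫₀¹ f(u) du` on `C[0,1]`. -/
def integralFunctional : StrongDual ℝ C(I, ℝ) :=
  LinearMap.mkContinuous
    { toFun := fun f => ∫ u, f u
      map_add' := fun f g => integral_add (integrable_C f) (integrable_C g)
      map_smul' := fun r f => integral_const_mul r f } 1
    (fun f => by simpa using abs_integral_C_le f)

/-- Multiplication by `g`, as a bounded operator on `C[0,1]`. -/
def mulOp (g : C(I, ℝ)) : C(I, ℝ) →L[ℝ] C(I, ℝ) := ContinuousLinearMap.mul ℝ C(I, ℝ) g

/-- The measure `g(u) du`, as an element of the dual of `C[0,1]`. -/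
def densityFunctional (g : C(I, ℝ)) : StrongDual ℝ C(I, ℝ) :=
  integralFunctional.comp (mulOp g)

theorem densityFunctional_apply (g f : C(I, ℝ)) :
    densityFunctional g f = ∫ u, g u * f u := rfl

/-- The integral operator `f ↦ ∫₀¹ k(·, v) f(v) dv` on `C[0,1]`. -/
def kernelOp (k : C(I × I, ℝ)) : C(I, ℝ) →L[ℝ] C(I, ℝ) :=
  LinearMap.mkContinuous
    { toFun := fun f => ⟨fun u => integralFunctional (k.curry u * f),
        integralFunctional.continuous.comp (k.curry.continuous.mul continuous_const)⟩
      map_add' := fun f g => by ext u; simp [mul_add]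
      map_smul' := fun r f => by ext u; simp } ‖k‖
    (fun f => by
      refine (ContinuousMap.norm_le _ (by positivity)).2 fun u => ?_
      refine (abs_integral_C_le (k.curry u * f)).trans ((norm_mul_le _ _).trans ?_)
      refine mul_le_mul_of_nonneg_right ?_ (norm_nonneg f)
      exact (ContinuousMap.norm_le _ (norm_nonneg k)).2 fun v => k.norm_coe_le_norm (u, v))

theorem kernelOp_apply (k : C(I × I, ℝ)) (f : C(I, ℝ)) (u : I) :
    kernelOp k f u = ∫ v, k (u, v) * f v := rfl

/-- The kernel `(u, v) ↦ k(v, u)`. -/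
def swapK (k : C(I × I, ℝ)) : C(I × I, ℝ) := k.comp ⟨Prod.swap, continuous_swap⟩

/-- The bounded operator on `C[0,1]` which drives the density `ρ(t, ·)` of the hydrodynamic limit;
see `hydroOp_apply`. -/
def hydroOp (M : Coeffs) : C(I, ℝ) →L[ℝ] C(I, ℝ) :=
  mulOp (toR M.b * (toR M.c - 1)) +
    mulOp (kernelOp (swapK (toR M.lam * (toR M.a₄ - 1))) 1) +
    mulOp (kernelOp (toR M.lam * (toR M.a₁ - 1)) 1) +
    kernelOp (toR M.lam * toR M.a₂) +
    kernelOp (swapK (toR M.lam * toR M.a₃))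

theorem hydroOp_apply (M : Coeffs) (f : C(I, ℝ)) (u : I) :
    hydroOp M f u =
      (M.b u : ℝ) * (M.c u - 1) * f u
      + f u * (∫ v, (M.lam (v, u) : ℝ) * (M.a₄ (v, u) - 1))
      + f u * (∫ v, (M.lam (u, v) : ℝ) * (M.a₁ (u, v) - 1))
      + (∫ v, (M.lam (u, v) : ℝ) * M.a₂ (u, v) * f v)
      + (∫ v, (M.lam (v, u) : ℝ) * M.a₃ (v, u) * f v) := by
  simp [hydroOp, mulOp, kernelOp_apply, toR, swapK, mul_comm (f u)]

/-- `ρ : [0, ∞) → C[0,1]` solves the linear equation `dρ/dt = hydroOp ρ`, `ρ(0, ·) = φ`, in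
`C[0,1]` with the supremum norm (values of `ρ` at negative times are irrelevant). -/
def IsHydroDensity (M : Coeffs) (φ : C(I, ℝ)) (ρ : ℝ → C(I, ℝ)) : Prop :=
  ρ 0 = φ ∧ ∀ t, 0 ≤ t → HasDerivWithinAt ρ (hydroOp M (ρ t)) (Set.Ici 0) t

/-- `P₃ f(u) = (c²(u) - 1) b(u) f(u)`. -/
def P₃ (M : Coeffs) : C(I, ℝ) →L[ℝ] C(I, ℝ) := mulOp ((toR M.c ^ 2 - 1) * toR M.b)

/-- `P₄ f(u) = f(u) ∫ λ(u,v) (a₁²(u,v) - 1) dv`. -/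
def P₄ (M : Coeffs) : C(I, ℝ) →L[ℝ] C(I, ℝ) :=
  mulOp (kernelOp (toR M.lam * (toR M.a₁ ^ 2 - 1)) 1)

/-- `P₅ f(u) = ∫ λ(v,u) a₂²(v,u) f(v) dv`. -/
def P₅ (M : Coeffs) : C(I, ℝ) →L[ℝ] C(I, ℝ) := kernelOp (swapK (toR M.lam * toR M.a₂ ^ 2))

/-- `P₆ f(u) = ∫ λ(u,v) a₃²(u,v) f(v) dv`. -/
def P₆ (M : Coeffs) : C(I, ℝ) →L[ℝ] C(I, ℝ) := kernelOp (toR M.lam * toR M.a₃ ^ 2)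

/-- `P₇ f(u) = f(u) ∫ λ(v,u) (a₄²(v,u) - 1) dv`. -/
def P₇ (M : Coeffs) : C(I, ℝ) →L[ℝ] C(I, ℝ) :=
  mulOp (kernelOp (swapK (toR M.lam * (toR M.a₄ ^ 2 - 1))) 1)

/-- `P₂ = P₃ + P₄ + P₅ + P₆ + P₇`. -/
def P₂ (M : Coeffs) : C(I, ℝ) →L[ℝ] C(I, ℝ) := P₃ M + P₄ M + P₅ M + P₆ M + P₇ M

theorem P₂_apply (M : Coeffs) (f : C(I, ℝ)) (u : I) :
    P₂ M f u =
      ((M.c u : ℝ) ^ 2 - 1) * M.b u * f u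
      + f u * (∫ v, (M.lam (u, v) : ℝ) * ((M.a₁ (u, v) : ℝ) ^ 2 - 1))
      + (∫ v, (M.lam (v, u) : ℝ) * (M.a₂ (v, u) : ℝ) ^ 2 * f v)
      + (∫ v, (M.lam (u, v) : ℝ) * (M.a₃ (u, v) : ℝ) ^ 2 * f v)
      + f u * (∫ v, (M.lam (v, u) : ℝ) * ((M.a₄ (v, u) : ℝ) ^ 2 - 1)) := by
  simp [P₂, P₃, P₄, P₅, P₆, P₇, mulOp, kernelOp_apply, toR, swapK, mul_comm (f u)]

/-- The adjoint `A^*` of a bounded operator `A` on `C[0,1]`: `(A^* ν)(f) = ν(A f)`. -/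
def adj (A : C(I, ℝ) →L[ℝ] C(I, ℝ)) (ν : StrongDual ℝ C(I, ℝ)) : StrongDual ℝ C(I, ℝ) :=
  ν.comp A

/-- The functional `l₁`, where `r = ρ(t, ·)`; see `lOne_apply`. -/
def lOne (M : Coeffs) (r : C(I, ℝ)) : StrongDual ℝ C(I, ℝ) :=
  (2 : ℝ) • densityFunctional (r * kernelOp (toR M.a₁ * toR M.a₂ * toR M.lam) r) +
    (2 : ℝ) • densityFunctional (r * kernelOp (swapK (toR M.lam * toR M.a₃ * toR M.a₄)) r)

theorem lOne_apply (M : Coeffs) (r f : C(I, ℝ)) :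
    lOne M r f =
      2 * (∫ u, ∫ v, r u * r v * M.a₁ (u, v) * M.a₂ (u, v) * M.lam (u, v) * f u)
      + 2 * (∫ u, ∫ v, M.lam (v, u) * M.a₃ (v, u) * M.a₄ (v, u) * r u * r v * f u) := by
  simp only [lOne, add_apply, smul_apply, smul_eq_mul,
    densityFunctional_apply, ContinuousMap.mul_apply, kernelOp_apply, ← integral_const_mul,
    ← integral_mul_const]
  congr 1
  · refine integral_congr_ae (Eventually.of_forall fun u => ?_)
    refine integral_congr_ae (Eventually.of_forall fun v => ?_)
    simp only [toR, ContinuousMap.coe_mk]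
    ring
  · refine integral_congr_ae (Eventually.of_forall fun u => ?_)
    refine integral_congr_ae (Eventually.of_forall fun v => ?_)
    simp only [toR, swapK, ContinuousMap.coe_mk, ContinuousMap.comp_apply,
      ContinuousMap.mul_apply, Prod.swap_prod_mk]
    ring

/-- `θ : [0, T] → C[0,1]'` solves `dθ/dt = P₂^* θ + l_{1,t}` for `0 ≤ t ≤ T`, `θ₀ = φ(u) du`, in
the dual of `C[0,1]` with the dual norm (values of `θ` outside `[0, T]` are irrelevant). -/
def IsThetaSolution (M : Coeffs) (φ : C(I, ℝ)) (ρ : ℝ → C(I, ℝ)) (T : ℝ)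
    (θ : ℝ → StrongDual ℝ C(I, ℝ)) : Prop :=
  θ 0 = densityFunctional φ ∧
    ∀ t ∈ Set.Icc 0 T,
      HasDerivWithinAt θ (adj (P₂ M) (θ t) + lOne M (ρ t)) (Set.Icc 0 T) t

end NUrn

end

/-! Write ν_p(f) for the empirical average `powEmp p f`, that is (1/N) ∑ x(i)^p f(i/N). The
generator applied to ν_p(f) gives ν_p(A_p f), with A_p = `driftOp M p`, plus the contribution
`crossTerm` of the mixed products of x(i) and x(j), plus an error that vanishes as N → ∞: Riemann
sums in place of integrals, and diagonal terms (`gen_powEmp_approx`). A jump changes at most two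
summands, so it moves ν_p(f) by order 1/N, while the total jump rate is of order N; hence the carré
du champ is of order 1/N (`gam_powEmp_le`).

The law of large numbers at a time t (`powEmp_lln`) follows by duality. The test function f_s =
exp((t - s) A_p) g satisfies f' = -A_p f, so the linear part of the drift of ν_p(f_s) cancels. If r'
= A_p^* r + h, then ∫ r_s f_s has derivative ∫ h_s f_s. The centred variable Z_s = ν_p(f_s) - ∫ r_s
f_s therefore has drift D equal to a small error plus `crossTerm` minus ∫ h_s f_s, and (d/ds) E Z² ≤
E Z² + E(D² + Γ), with Γ the carré du champ. Gronwall concludes, starting from time 0, where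
independence makes the variance O(1/N). The supremum over t stands outside the expectation, so no
maximal inequality is needed; uniformity in t holds because all the f_s stay in one compact subset
of C[0,1], on which Riemann sums converge uniformly.

This is used twice. For p = 1 there is no mixed product, and r is ρ. For p = 2 the interaction is a
quadratic expression in the first-order empirical measure, so the case p = 1 together with sixth
moments gives its limit l_{1,t} (`crossTerm_two_limit`). The density y of θ solves the corresponding
linear equation in C[0,1], by variation of constants; uniqueness in the dual space holds because the
equation is Lipschitz.

Underneath lies the forward equation. It is immediate for bounded functions, since the generator is
a bounded operator. Applied to truncated powers it yields moment bounds uniform in the truncation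
level, and dominated convergence then extends it to continuous functions bounded by a multiple of 1
+ ∑ x(k)^6. The sixth power covers the squares of ν_p for p ≤ 3 and the sixth moments used for the
interaction. -/

noncomputable section

namespace NUrn

/-! ### Elementary inequalities -/

/-- A differential Gronwall inequality on `[0, t]`. -/
theorem gronwall_of_deriv_le {h h' : ℝ → ℝ} {C η t : ℝ} (ht : 0 ≤ t) (hC : 0 ≤ C) (hη : 0 ≤ η)
    (hc : ContinuousOn h (Set.Icc 0 t))
    (hd : ∀ s ∈ Set.Ioo 0 t, HasDerivAt h (h' s) s)
    (hle : ∀ s ∈ Set.Ioo 0 t, h' s ≤ C * h s + η) :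
    h t ≤ Real.exp (C * t) * (h 0 + η * t) := by
  -- With the integrating factor the derivative is at most η (exp(-Cs) - 1), which is nonpositive
  -- because C and s are nonnegative.
  have key : AntitoneOn (fun s => Real.exp (-(C * s)) * h s - η * s) (Set.Icc 0 t) := by
    have hder : ∀ s ∈ Set.Ioo 0 t, HasDerivAt (fun s => Real.exp (-(C * s)) * h s - η * s)
        (Real.exp (-(C * s)) * (-(C * 1)) * h s + Real.exp (-(C * s)) * h' s - η * 1) s :=
      fun s hs => (((((hasDerivAt_id s).const_mul C).neg).exp).mul (hd s hs)).sub
        ((hasDerivAt_id s).const_mul η)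
    refine antitoneOn_of_deriv_nonpos (convex_Icc 0 t) ?_ ?_ ?_
    · exact ((by fun_prop : Continuous fun s => Real.exp (-(C * s))).continuousOn.mul hc).sub
        (by fun_prop)
    · rw [interior_Icc]
      exact fun s hs => (hder s hs).differentiableAt.differentiableWithinAt
    · rw [interior_Icc]
      intro s hs
      rw [(hder s hs).deriv]
      have h1 := hle s hs
      have h2 : Real.exp (-(C * s)) ≤ 1 :=
        Real.exp_le_one_iff.2 (neg_nonpos.2 (mul_nonneg hC hs.1.le))
      have h3 := Real.exp_pos (-(C * s))
      nlinarith [mul_le_mul_of_nonneg_left h1 h3.le]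
  have h1 := key (Set.left_mem_Icc.2 ht) (Set.right_mem_Icc.2 ht) ht
  simp only [mul_zero, neg_zero, Real.exp_zero, one_mul, sub_zero] at h1
  have h2 : h t = Real.exp (C * t) * (Real.exp (-(C * t)) * h t) := by
    rw [← mul_assoc, ← Real.exp_add]; simp
  rw [h2]
  gcongr
  linarith

theorem pow_linear_le {K a a' x y : ℝ} (ha : 0 ≤ a) (ha' : 0 ≤ a') (hx : 0 ≤ x) (hy : 0 ≤ y)
    (haK : a ≤ K) (haK' : a' ≤ K) (p : ℕ) :
    (a * x + a' * y) ^ p ≤ (2 * K) ^ p * (x ^ p + y ^ p) := by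
  have hK : 0 ≤ K := ha.trans haK
  have h1 : a * x + a' * y ≤ 2 * K * max x y := by
    have := mul_le_mul haK (le_max_left x y) hx hK
    have := mul_le_mul haK' (le_max_right x y) hy hK
    linarith
  calc (a * x + a' * y) ^ p ≤ (2 * K * max x y) ^ p := by gcongr
    _ = (2 * K) ^ p * (max x y) ^ p := mul_pow _ _ _
    _ ≤ (2 * K) ^ p * (x ^ p + y ^ p) := by
      gcongr
      rcases le_total x y with h | h
      · rw [max_eq_right h]; have := pow_nonneg hx p; linarith
      · rw [max_eq_left h]; have := pow_nonneg hy p; linarith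

/-- If u or v exceeds m, the right side is already at least κm ≥ m. A bound z ≤ κ(u + v) thus
survives truncation at every level with the same κ, which is what makes the moment bounds
independent of the level. -/
theorem min_le_mul_min_add_min {κ z u v m : ℝ} (hκ : 1 ≤ κ) (hm : 0 ≤ m) (hu : 0 ≤ u) (hv : 0 ≤ v)
    (h : z ≤ κ * (u + v)) : min z m ≤ κ * (min u m + min v m) := by
  rcases le_total u m with h1 | h1
  · rcases le_total v m with h2 | h2
    · rw [min_eq_left h1, min_eq_left h2]; exact (min_le_left _ _).trans h
    · rw [min_eq_left h1, min_eq_right h2]; exact (min_le_right _ _).trans (by nlinarith)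
  · rw [min_eq_right h1]
    have : 0 ≤ min v m := le_min hv hm
    exact (min_le_right _ _).trans (by nlinarith)

/-! ### Jumps -/

/-- `K` is a common upper bound of all the parameters of the model. -/
structure Coeffs.BoundedBy (M : Coeffs) (K : ℝ) : Prop where
  one_le : 1 ≤ K
  b_le : ∀ u, (M.b u : ℝ) ≤ K
  c_le : ∀ u, (M.c u : ℝ) ≤ K
  lam_le : ∀ z, (M.lam z : ℝ) ≤ K
  a₁_le : ∀ z, (M.a₁ z : ℝ) ≤ K
  a₂_le : ∀ z, (M.a₂ z : ℝ) ≤ K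
  a₃_le : ∀ z, (M.a₃ z : ℝ) ≤ K
  a₄_le : ∀ z, (M.a₄ z : ℝ) ≤ K

theorem Coeffs.exists_boundedBy (M : Coeffs) : ∃ K, M.BoundedBy K := by
  have key : ∀ {Y : Type} [TopologicalSpace Y] [CompactSpace Y] (g : C(Y, ℝ≥0)) (y : Y),
      (g y : ℝ) ≤ ‖toR g‖ := fun g y => (le_abs_self _).trans ((toR g).norm_coe_le_norm y)
  refine ⟨1 + ‖toR M.b‖ + ‖toR M.c‖ + ‖toR M.lam‖ + ‖toR M.a₁‖ + ‖toR M.a₂‖ + ‖toR M.a₃‖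
    + ‖toR M.a₄‖, ?_⟩
  have h1 := norm_nonneg (toR M.b)
  have h2 := norm_nonneg (toR M.c)
  have h3 := norm_nonneg (toR M.lam)
  have h4 := norm_nonneg (toR M.a₁)
  have h5 := norm_nonneg (toR M.a₂)
  have h6 := norm_nonneg (toR M.a₃)
  have h7 := norm_nonneg (toR M.a₄)
  constructor
  · linarith
  · intro u; linarith [key M.b u]
  · intro u; linarith [key M.c u]
  · intro u; linarith [key M.lam u]
  · intro u; linarith [key M.a₁ u]
  · intro u; linarith [key M.a₂ u]
  · intro u; linarith [key M.a₃ u]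
  · intro u; linarith [key M.a₄ u]

/-- The sum of the values of `g` after each possible jump from `x`, weighted by the jump rates. -/
def jumpSum (M : Coeffs) {N : ℕ} (g : State N → ℝ) (x : State N) : ℝ :=
  ∑ i : Fin N, (M.b (pos i) : ℝ) * g (jumpSite M i x) +
    (1 / N : ℝ) * ∑ i : Fin N, ∑ j ∈ Finset.univ.filter (fun j => j ≠ i),
      (M.lam (pos i, pos j) : ℝ) * g (jumpPair M i j x)

/-- The generator applied to an arbitrary function. -/
def gen (M : Coeffs) {N : ℕ} (f : State N → ℝ) (x : State N) : ℝ :=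
  jumpSum M (fun y => f y - f x) x

theorem generator_eq_gen (M : Coeffs) (N : ℕ) (f : State N →ᵇ ℝ) (x : State N) :
    generator M N f x = gen M f x := generator_apply M N f x

theorem jumpSum_add (M : Coeffs) {N : ℕ} (f g : State N → ℝ) (x : State N) :
    jumpSum M (fun y => f y + g y) x = jumpSum M f x + jumpSum M g x := by
  simp only [jumpSum, mul_add, Finset.sum_add_distrib]
  ring

theorem jumpSum_const_mul (M : Coeffs) {N : ℕ} (r : ℝ) (f : State N → ℝ) (x : State N) :
    jumpSum M (fun y => r * f y) x = r * jumpSum M f x := by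
  simp only [jumpSum, mul_add, Finset.mul_sum]
  congr 1
  · exact Finset.sum_congr rfl fun i _ => by ring
  · exact Finset.sum_congr rfl fun i _ => Finset.sum_congr rfl fun j _ => by ring

theorem jumpSum_mono (M : Coeffs) {N : ℕ} {f g : State N → ℝ} (x : State N) (h : ∀ y, f y ≤ g y) :
    jumpSum M f x ≤ jumpSum M g x := by
  unfold jumpSum
  gcongr <;> exact h _

theorem abs_jumpSum_le (M : Coeffs) {N : ℕ} (f : State N → ℝ) (x : State N) :
    |jumpSum M f x| ≤ jumpSum M (fun y => |f y|) x := by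
  rw [abs_le]
  constructor
  · have := jumpSum_mono M x (f := fun y => -1 * |f y|) (g := f)
      (fun y => by linarith [neg_abs_le (f y)])
    rw [jumpSum_const_mul] at this
    linarith
  · exact jumpSum_mono M x fun y => le_abs_self _

/-- If the jump at `i` contributes at most `A i` and the jump at `(i, j)` at most `A i + A j`,
then all the jumps together contribute at most a constant times `∑ A i`. -/
theorem jumpSum_le {M : Coeffs} {K : ℝ} (hK : M.BoundedBy K) {N : ℕ} {g : State N → ℝ}
    {x : State N} {A : Fin N → ℝ} (hA : ∀ i, 0 ≤ A i) (hs : ∀ i, g (jumpSite M i x) ≤ A i)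
    (hp : ∀ i j, j ≠ i → g (jumpPair M i j x) ≤ A i + A j) :
    jumpSum M g x ≤ 3 * K * ∑ i, A i := by
  have hK0 : 0 ≤ K := zero_le_one.trans hK.one_le
  have h1 : ∑ i : Fin N, (M.b (pos i) : ℝ) * g (jumpSite M i x) ≤ K * ∑ i, A i := by
    rw [Finset.mul_sum]
    refine Finset.sum_le_sum fun i _ => ?_
    exact (mul_le_mul_of_nonneg_left (hs i) (M.b _).2).trans
      (mul_le_mul_of_nonneg_right (hK.b_le _) (hA i))
  have h2 : ∑ i : Fin N, ∑ j ∈ Finset.univ.filter (fun j => j ≠ i),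
      (M.lam (pos i, pos j) : ℝ) * g (jumpPair M i j x) ≤ N * (2 * K * ∑ i, A i) := by
    calc _ ≤ ∑ i : Fin N, ∑ j : Fin N, K * (A i + A j) := by
          refine Finset.sum_le_sum fun i _ => ?_
          refine (Finset.sum_le_sum (g := fun j => K * (A i + A j)) fun j hj => ?_).trans
            (Finset.sum_le_sum_of_subset_of_nonneg (Finset.filter_subset _ _)
              fun j _ _ => mul_nonneg hK0 (add_nonneg (hA i) (hA j)))
          exact (mul_le_mul_of_nonneg_left (hp i j (Finset.mem_filter.1 hj).2) (M.lam _).2).trans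
            (mul_le_mul_of_nonneg_right (hK.lam_le _) (add_nonneg (hA i) (hA j)))
      _ = N * (2 * K * ∑ i, A i) := by
          simp only [← Finset.mul_sum, Finset.sum_add_distrib, Finset.sum_const, Finset.card_univ,
            Fintype.card_fin, nsmul_eq_mul]
          ring
  rcases Nat.eq_zero_or_pos N with rfl | hN
  · simp [jumpSum]
  have hN' : (0 : ℝ) < N := by exact_mod_cast hN
  calc jumpSum M g x ≤ K * ∑ i, A i + (1 / N : ℝ) * (N * (2 * K * ∑ i, A i)) := by
        unfold jumpSum; gcongr
    _ = 3 * K * ∑ i, A i := by field_simp; ring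

theorem sum_jumpSite_sub (M : Coeffs) {N : ℕ} (F : Fin N → ℝ≥0 → ℝ) (i : Fin N) (x : State N) :
    ∑ k, F k (jumpSite M i x k) - ∑ k, F k (x k) = F i (M.c (pos i) * x i) - F i (x i) := by
  rw [← Finset.sum_sub_distrib, Finset.sum_eq_single i]
  · simp [jumpSite]
  · intro k _ hk
    simp [jumpSite, hk]
  · simp

theorem sum_jumpPair_sub (M : Coeffs) {N : ℕ} (F : Fin N → ℝ≥0 → ℝ) {i j : Fin N} (hij : j ≠ i)
    (x : State N) :
    ∑ k, F k (jumpPair M i j x k) - ∑ k, F k (x k) =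
      (F i (M.a₁ (pos i, pos j) * x i + M.a₂ (pos i, pos j) * x j) - F i (x i)) +
      (F j (M.a₃ (pos i, pos j) * x i + M.a₄ (pos i, pos j) * x j) - F j (x j)) := by
  rw [← Finset.sum_sub_distrib, Fintype.sum_eq_add i j hij.symm]
  · simp [jumpPair, hij]
  · intro k hk
    simp [jumpPair, hk.1, hk.2]

/-- The growth of the powers of the coordinates, truncated at level `m`. -/
theorem gen_sum_min_pow_le {M : Coeffs} {K : ℝ} (hK : M.BoundedBy K) {N : ℕ} (p : ℕ) {m : ℝ}
    (hm : 0 ≤ m) (x : State N) :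
    gen M (fun y => ∑ k, min ((y k : ℝ) ^ p) m) x ≤
      6 * K * (2 * K) ^ p * ∑ k, min ((x k : ℝ) ^ p) m := by
  have hK0 : 0 ≤ K := zero_le_one.trans hK.one_le
  have hκ : 1 ≤ (2 * K) ^ p := one_le_pow₀ (by linarith [hK.one_le])
  have hmin : ∀ k, 0 ≤ min ((x k : ℝ) ^ p) m := fun k => le_min (by positivity) hm
  have hlin : ∀ (a a' : ℝ≥0) (i j : Fin N), (a : ℝ) ≤ K → (a' : ℝ) ≤ K →
      min (((a * x i + a' * x j : ℝ≥0) : ℝ) ^ p) m ≤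
        (2 * K) ^ p * (min ((x i : ℝ) ^ p) m + min ((x j : ℝ) ^ p) m) := by
    intro a a' i j ha ha'
    refine min_le_mul_min_add_min hκ hm (by positivity) (by positivity) ?_
    push_cast
    exact pow_linear_le a.2 a'.2 (x i).2 (x j).2 ha ha' p
  -- A pair jump changes two coordinates, each new truncated power being at most (2K)^p times the
  -- sum of the two old ones; this gives the factor 2 in `A`. A jump at one site is the linear case
  -- with second coefficient 0.
  have := jumpSum_le hK (x := x)
    (g := fun y => ∑ k, min ((y k : ℝ) ^ p) m - ∑ k, min ((x k : ℝ) ^ p) m)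
    (A := fun k => 2 * (2 * K) ^ p * min ((x k : ℝ) ^ p) m)
    (fun k => mul_nonneg (by positivity) (hmin k)) (fun i => ?_) (fun i j hij => ?_)
  · rw [← Finset.mul_sum] at this
    calc _ ≤ _ := this
      _ = _ := by ring
  · rw [sum_jumpSite_sub M (fun _ y => min ((y : ℝ) ^ p) m)]
    have h := hlin (M.c (pos i)) 0 i i (hK.c_le _) (by simpa using hK0)
    simp only [zero_mul, add_zero] at h
    linarith [hmin i]
  · rw [sum_jumpPair_sub M (fun _ y => min ((y : ℝ) ^ p) m) hij]
    have h := hlin _ _ i j (hK.a₁_le (pos i, pos j)) (hK.a₂_le (pos i, pos j))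
    have h' := hlin _ _ i j (hK.a₃_le (pos i, pos j)) (hK.a₄_le (pos i, pos j))
    linarith [hmin i, hmin j]

/-! ### The forward equation -/

/-- Fatou's lemma, applied to the limit of truncations whose integrals share one bound. -/
theorem integrable_of_tendsto_of_integral_le {Ω : Type*} [MeasurableSpace Ω]
    {P : Measure Ω} {F : ℕ → Ω → ℝ} {f : Ω → ℝ} {B : ℝ}
    (hF : ∀ m, Integrable (F m) P) (hF0 : ∀ m ω, 0 ≤ F m ω) (hB : ∀ m, ∫ ω, F m ω ∂P ≤ B)
    (hf : AEStronglyMeasurable f P) (h : ∀ ω, Tendsto (fun m => F m ω) atTop (𝓝 (f ω))) :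
    Integrable f P ∧ ∫ ω, f ω ∂P ≤ B := by
  have hf0 : ∀ ω, 0 ≤ f ω := fun ω => ge_of_tendsto' (h ω) fun m => hF0 m ω
  have hB0 : 0 ≤ B := (integral_nonneg (hF0 0)).trans (hB 0)
  have key : ∫⁻ ω, ENNReal.ofReal (f ω) ∂P ≤ ENNReal.ofReal B := by
    calc ∫⁻ ω, ENNReal.ofReal (f ω) ∂P
        = ∫⁻ ω, liminf (fun m => ENNReal.ofReal (F m ω)) atTop ∂P := by
          refine lintegral_congr fun ω => ?_
          exact ((ENNReal.continuous_ofReal.tendsto _).comp (h ω)).liminf_eq.symm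
      _ ≤ liminf (fun m => ∫⁻ ω, ENNReal.ofReal (F m ω) ∂P) atTop :=
          lintegral_liminf_le' fun m => (hF m).aestronglyMeasurable.aemeasurable.ennreal_ofReal
      _ ≤ ENNReal.ofReal B := by
          refine liminf_le_of_le (by isBoundedDefault) fun b hb => ?_
          obtain ⟨m, hm⟩ := hb.exists
          refine hm.trans ?_
          rw [← ofReal_integral_eq_lintegral_ofReal (hF m) (Eventually.of_forall (hF0 m))]
          exact ENNReal.ofReal_le_ofReal (hB m)
  have hint : Integrable f P := by
    refine ⟨hf, ?_⟩
    rw [hasFiniteIntegral_iff_ofReal (Eventually.of_forall hf0)]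
    exact key.trans_lt ENNReal.ofReal_lt_top
  refine ⟨hint, ?_⟩
  rwa [← ofReal_integral_eq_lintegral_ofReal hint (Eventually.of_forall hf0),
    ENNReal.ofReal_le_ofReal_iff hB0] at key

section Forward

variable {M : Coeffs} {N : ℕ} {Ω : Type*} [MeasurableSpace Ω] {P : Measure Ω}
  [IsProbabilityMeasure P] {X : ℝ≥0 → Ω → State N}

theorem integrable_bounded_comp {Y : Ω → State N} (hY : Measurable Y) (f : State N →ᵇ ℝ) :
    Integrable (fun ω => f (Y ω)) P :=
  Integrable.of_bound (f.continuous.measurable.comp hY).aestronglyMeasurable ‖f‖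
    (Eventually.of_forall fun ω => f.norm_coe_le_norm (Y ω))

/-- The law of `Y`, as a functional on bounded continuous functions. -/
def lawFunctional (P : Measure Ω) [IsProbabilityMeasure P] {Y : Ω → State N} (hY : Measurable Y) :
    (State N →ᵇ ℝ) →L[ℝ] ℝ :=
  LinearMap.mkContinuous
    { toFun := fun f => ∫ ω, f (Y ω) ∂P
      map_add' := fun f g => integral_add (integrable_bounded_comp hY f)
        (integrable_bounded_comp hY g)
      map_smul' := fun r f => integral_const_mul r _ } 1
    (fun f => by
      have h := norm_integral_le_of_norm_le_const (μ := P)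
        (Eventually.of_forall fun ω => f.norm_coe_le_norm (Y ω))
      simpa using h)

/-- The Markov property between times 0 and t, integrated: the conditional expectation has the same
mean as the variable. -/
theorem IsLinearSystem.integral_eq (hX : IsLinearSystem M N P X) (t : ℝ≥0) (f : State N →ᵇ ℝ) :
    ∫ ω, f (X t ω) ∂P =
      lawFunctional P (hX.measurable 0) (opExp ((t : ℝ) • generator M N) f) := by
  have hm : past X 0 ≤ (inferInstance : MeasurableSpace Ω) :=
    iSup_le fun r => (hX.measurable r).comap_le
  have h1 := hX.markov 0 t f
  rw [← integral_condExp hm, ← zero_add t, integral_congr_ae h1, zero_add]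
  rfl

theorem hasDerivAt_opExp_apply {E : Type*} [NormedAddCommGroup E] [NormedSpace ℝ E]
    [CompleteSpace E] (A : E →L[ℝ] E) (f : E) (t : ℝ) :
    HasDerivAt (fun s : ℝ => opExp (s • A) f) (opExp (t • A) (A f)) t := by
  simpa [opExp] using (hasDerivAt_exp_smul_const (𝕂 := ℝ) A t).clm_apply (hasDerivAt_const t f)

/-- The expectation of `f` at time `t` (at time `0` if `t < 0`). -/
def expect (P : Measure Ω) (X : ℝ≥0 → Ω → State N) (t : ℝ) (f : State N → ℝ) : ℝ :=
  ∫ ω, f (X t.toNNReal ω) ∂P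

theorem IsLinearSystem.hasDerivAt_semigroup (hX : IsLinearSystem M N P X) (f : State N →ᵇ ℝ)
    (t : ℝ) :
    HasDerivAt (fun s : ℝ => lawFunctional P (hX.measurable 0) (opExp (s • generator M N) f))
      (lawFunctional P (hX.measurable 0) (opExp (t • generator M N) (generator M N f))) t := by
  have h := (lawFunctional P (hX.measurable 0)).hasFDerivAt.comp_hasDerivAt t
    (hasDerivAt_opExp_apply (generator M N) f t)
  exact h

theorem IsLinearSystem.expect_eq (hX : IsLinearSystem M N P X) (f : State N →ᵇ ℝ) {t : ℝ}
    (ht : 0 ≤ t) :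
    expect P X t f = lawFunctional P (hX.measurable 0) (opExp (t • generator M N) f) := by
  rw [expect, hX.integral_eq, Real.coe_toNNReal t ht]

/-- `expect` is frozen at its time-0 value for negative times, so it is the differentiable semigroup
expression composed with t ↦ max t 0. The composition may have a corner at 0, hence two-sided
derivatives are claimed only for t > 0. -/
theorem IsLinearSystem.continuous_expect_bounded (hX : IsLinearSystem M N P X)
    (f : State N →ᵇ ℝ) : Continuous fun t => expect P X t f := by
  have h1 : Continuous fun s : ℝ =>
      lawFunctional P (hX.measurable 0) (opExp (s • generator M N) f) :=
    continuous_iff_continuousAt.2 fun t => (hX.hasDerivAt_semigroup f t).continuousAt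
  have h2 : (fun t => expect P X t f) = fun t =>
      lawFunctional P (hX.measurable 0) (opExp ((max t 0) • generator M N) f) := by
    ext t
    rw [← hX.expect_eq f (le_max_right t 0)]
    rcases le_total t 0 with h | h
    · simp [expect, Real.toNNReal_of_nonpos h, h]
    · rw [max_eq_left h]
  rw [h2]
  exact h1.comp (by fun_prop : Continuous fun t : ℝ => max t 0)

theorem IsLinearSystem.hasDerivAt_expect_bounded (hX : IsLinearSystem M N P X)
    (f : State N →ᵇ ℝ) {t : ℝ} (ht : 0 < t) :
    HasDerivAt (fun s => expect P X s f) (expect P X t (gen M f)) t := by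
  have h1 : expect P X t (gen M f) = expect P X t (generator M N f) := by
    simp only [expect, generator_eq_gen]
  rw [h1, hX.expect_eq _ ht.le]
  refine (hX.hasDerivAt_semigroup f t).congr_of_eventuallyEq ?_
  filter_upwards [lt_mem_nhds ht] with s hs using hX.expect_eq f hs.le

theorem IsLinearSystem.expect_sub_eq_bounded (hX : IsLinearSystem M N P X)
    (f : State N →ᵇ ℝ) {t : ℝ} (ht : 0 ≤ t) :
    expect P X t f - expect P X 0 f = ∫ s in (0 : ℝ)..t, expect P X s (gen M f) := by
  have h1 : (fun s => expect P X s (gen M f)) = fun s => expect P X s (generator M N f) := by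
    ext s
    simp only [expect, generator_eq_gen]
  symm
  refine intervalIntegral.integral_eq_sub_of_hasDerivAt_of_le ht
    (hX.continuous_expect_bounded f).continuousOn
    (fun s hs => hX.hasDerivAt_expect_bounded f hs.1) ?_
  rw [h1]
  exact (hX.continuous_expect_bounded _).intervalIntegrable _ _

/-! ### Moments -/

/-- The sum of the truncated powers of the coordinates. -/
def truncPow (N p : ℕ) {m : ℝ} (hm : 0 ≤ m) : State N →ᵇ ℝ :=
  BoundedContinuousFunction.ofNormedAddCommGroup
    (fun x => ∑ k, min ((x k : ℝ) ^ p) m) (by fun_prop) (N * m) (fun x => by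
      rw [Real.norm_of_nonneg (Finset.sum_nonneg fun k _ => le_min (by positivity) hm)]
      calc _ ≤ ∑ k : Fin N, m := Finset.sum_le_sum fun k _ => min_le_right _ _
        _ = N * m := by simp)

theorem truncPow_apply (p : ℕ) {m : ℝ} (hm : 0 ≤ m) (x : State N) :
    truncPow N p hm x = ∑ k, min ((x k : ℝ) ^ p) m := rfl

/-- Gronwall with a rate free of m and N; the initial value is at most N because every coordinate
starts in {0, 1}. Letting m → ∞ by Fatou then gives `moment_bound`. -/
theorem expect_trunc_le {K : ℝ} (hK : M.BoundedBy K) (hX : IsLinearSystem M N P X)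
    (h0 : ∀ᵐ ω ∂P, ∀ i, X 0 ω i = 0 ∨ X 0 ω i = 1) (p : ℕ) {m : ℝ} (hm : 0 ≤ m) {t : ℝ}
    (ht : 0 ≤ t) :
    expect P X t (truncPow N p hm) ≤ N * Real.exp (6 * K * (2 * K) ^ p * t) := by
  have hK0 : 0 ≤ K := zero_le_one.trans hK.one_le
  have hgen : ∀ s, expect P X s (gen M (truncPow N p hm)) ≤
      6 * K * (2 * K) ^ p * expect P X s (truncPow N p hm) := by
    intro s
    rw [expect, expect, ← integral_const_mul]
    refine integral_mono ?_ ?_ fun ω => gen_sum_min_pow_le hK p hm _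
    · simp_rw [← generator_eq_gen]
      exact integrable_bounded_comp (hX.measurable _) _
    · exact (integrable_bounded_comp (hX.measurable _) _).const_mul _
  have h1 := gronwall_of_deriv_le (h := fun s => expect P X s (truncPow N p hm))
    (C := 6 * K * (2 * K) ^ p) (η := 0) ht
    (by positivity) le_rfl (hX.continuous_expect_bounded _).continuousOn
    (fun s hs => hX.hasDerivAt_expect_bounded _ hs.1) (fun s _ => by simpa using hgen s)
  refine h1.trans ?_
  rw [mul_comm]
  gcongr
  rw [zero_mul, add_zero, expect, Real.toNNReal_zero]
  have h2 : ∫ ω, truncPow N p hm (X 0 ω) ∂P ≤ ∫ _, (N : ℝ) ∂P := by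
    refine integral_mono_ae (integrable_bounded_comp (hX.measurable _) _)
      (integrable_const _) ?_
    filter_upwards [h0] with ω hω
    calc truncPow N p hm (X 0 ω) ≤ ∑ k : Fin N, (1 : ℝ) := by
          rw [truncPow_apply]
          refine Finset.sum_le_sum fun k _ => (min_le_left _ _).trans ?_
          refine pow_le_one₀ (by positivity) ?_
          rcases hω k with h | h <;> simp [h]
      _ = N := by simp
  simpa using h2

theorem moment_bound {K : ℝ} (hK : M.BoundedBy K) (hX : IsLinearSystem M N P X)
    (h0 : ∀ᵐ ω ∂P, ∀ i, X 0 ω i = 0 ∨ X 0 ω i = 1) (p : ℕ) {t : ℝ} (ht : 0 ≤ t) :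
    Integrable (fun ω => ∑ k, (X t.toNNReal ω k : ℝ) ^ p) P ∧
      expect P X t (fun x => ∑ k, (x k : ℝ) ^ p) ≤ N * Real.exp (6 * K * (2 * K) ^ p * t) := by
  refine integrable_of_tendsto_of_integral_le
    (F := fun (m : ℕ) ω => truncPow N p (Nat.cast_nonneg m) (X t.toNNReal ω))
    (fun m => integrable_bounded_comp (hX.measurable _) _) (fun m ω => ?_)
    (fun m => expect_trunc_le hK hX h0 p _ ht) ?_ fun ω => ?_
  · rw [truncPow_apply]
    exact Finset.sum_nonneg fun k _ => le_min (by positivity) (by positivity)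
  · exact ((by fun_prop : Continuous fun x : State N =>
      ∑ k, (x k : ℝ) ^ p).measurable.comp (hX.measurable _)).aestronglyMeasurable
  · refine tendsto_finsetSum _ fun k _ => tendsto_const_nhds.congr' ?_
    obtain ⟨n, hn⟩ := exists_nat_ge ((X t.toNNReal ω k : ℝ) ^ p)
    filter_upwards [eventually_ge_atTop n] with m hm
    exact (min_eq_left (hn.trans (by exact_mod_cast hm))).symm

end Forward

/-! ### Functions of polynomial growth -/

/-- Continuous functions growing at most like the sixth power. -/
def PolyGrowth {N : ℕ} (f : State N → ℝ) : Prop :=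
  Continuous f ∧ ∃ C : ℝ, 0 ≤ C ∧ ∀ x, |f x| ≤ C * (1 + ∑ k, (x k : ℝ) ^ 6)

theorem one_le_weight {N : ℕ} (x : State N) : 1 ≤ 1 + ∑ k, (x k : ℝ) ^ 6 :=
  le_add_of_nonneg_right (Finset.sum_nonneg fun k _ => by positivity)

theorem PolyGrowth.add {N : ℕ} {f g : State N → ℝ} (hf : PolyGrowth f) (hg : PolyGrowth g) :
    PolyGrowth (fun x => f x + g x) := by
  obtain ⟨hfc, C, hC, hf⟩ := hf
  obtain ⟨hgc, D, hD, hg⟩ := hg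
  refine ⟨hfc.add hgc, C + D, by positivity, fun x => (abs_add_le _ _).trans ?_⟩
  rw [add_mul]
  exact add_le_add (hf x) (hg x)

theorem PolyGrowth.const_mul {N : ℕ} {f : State N → ℝ} (hf : PolyGrowth f) (r : ℝ) :
    PolyGrowth (fun x => r * f x) := by
  obtain ⟨hfc, C, hC, hf⟩ := hf
  refine ⟨hfc.const_mul r, |r| * C, by positivity, fun x => ?_⟩
  rw [abs_mul, mul_assoc]
  exact mul_le_mul_of_nonneg_left (hf x) (abs_nonneg r)

theorem PolyGrowth.sub {N : ℕ} {f g : State N → ℝ} (hf : PolyGrowth f) (hg : PolyGrowth g) :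
    PolyGrowth (fun x => f x - g x) := by
  simpa [sub_eq_add_neg] using hf.add (hg.const_mul (-1))

theorem PolyGrowth.const {N : ℕ} (r : ℝ) : PolyGrowth (fun _ : State N => r) :=
  ⟨continuous_const, |r|, abs_nonneg r, fun x =>
    le_mul_of_one_le_right (abs_nonneg r) (one_le_weight x)⟩

theorem PolyGrowth.sum {N : ℕ} {ι : Type*} (s : Finset ι) {f : ι → State N → ℝ}
    (hf : ∀ a ∈ s, PolyGrowth (f a)) : PolyGrowth (fun x => ∑ a ∈ s, f a x) := by
  classical
  induction s using Finset.induction_on with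
  | empty => simpa using PolyGrowth.const (N := N) 0
  | insert a s ha ih =>
    simp only [Finset.sum_insert ha]
    exact (hf a (Finset.mem_insert_self a s)).add
      (ih fun b hb => hf b (Finset.mem_insert_of_mem hb))

theorem sum_pow_jump_le {M : Coeffs} {K : ℝ} (hK : M.BoundedBy K) {N : ℕ} (x : State N) :
    (∀ i, 1 + ∑ k, (jumpSite M i x k : ℝ) ^ 6 ≤
      (1 + 2 * (2 * K) ^ 6) * (1 + ∑ k, (x k : ℝ) ^ 6)) ∧
    (∀ i j, j ≠ i → 1 + ∑ k, (jumpPair M i j x k : ℝ) ^ 6 ≤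
      (1 + 4 * (2 * K) ^ 6) * (1 + ∑ k, (x k : ℝ) ^ 6)) := by
  have hK0 : 0 ≤ K := zero_le_one.trans hK.one_le
  have hle : ∀ i, (x i : ℝ) ^ 6 ≤ ∑ k, (x k : ℝ) ^ 6 := fun i =>
    Finset.single_le_sum (f := fun k => (x k : ℝ) ^ 6) (fun k _ => by positivity)
      (Finset.mem_univ i)
  have hκ : 0 ≤ (2 * K) ^ 6 := by positivity
  have hlin : ∀ (a a' : ℝ≥0) (i j : Fin N), (a : ℝ) ≤ K → (a' : ℝ) ≤ K →
      (((a * x i + a' * x j : ℝ≥0) : ℝ) ^ 6) ≤ 2 * (2 * K) ^ 6 * ∑ k, (x k : ℝ) ^ 6 := by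
    intro a a' i j ha ha'
    push_cast
    refine (pow_linear_le a.2 a'.2 (x i).2 (x j).2 ha ha' 6).trans ?_
    refine (mul_le_mul_of_nonneg_left (add_le_add (hle i) (hle j)) hκ).trans (le_of_eq ?_)
    ring
  have hpos : ∀ i, 0 ≤ (x i : ℝ) ^ 6 := fun i => by positivity
  constructor
  · intro i
    have h1 := sum_jumpSite_sub M (fun _ y => (y : ℝ) ^ 6) i x
    have h2 := hlin (M.c (pos i)) 0 i i (hK.c_le _) (by simpa using hK0)
    simp only [zero_mul, add_zero] at h2
    linarith [hpos i]
  · intro i j hij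
    have h1 := sum_jumpPair_sub M (fun _ y => (y : ℝ) ^ 6) hij x
    have h2 := hlin _ _ i j (hK.a₁_le (pos i, pos j)) (hK.a₂_le (pos i, pos j))
    have h3 := hlin _ _ i j (hK.a₃_le (pos i, pos j)) (hK.a₄_le (pos i, pos j))
    linarith [hpos i, hpos j]

/-- The generator, applied to a function of growth at most `C`, has controlled growth. -/
theorem abs_gen_le {M : Coeffs} {K : ℝ} (hK : M.BoundedBy K) {N : ℕ} {f : State N → ℝ} {C : ℝ}
    (hC : 0 ≤ C) (hf : ∀ x, |f x| ≤ C * (1 + ∑ k, (x k : ℝ) ^ 6)) (x : State N) :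
    |gen M f x| ≤ 3 * K * N * (C * (2 + 4 * (2 * K) ^ 6)) * (1 + ∑ k, (x k : ℝ) ^ 6) := by
  have hK0 : 0 ≤ K := zero_le_one.trans hK.one_le
  have hw := one_le_weight x
  obtain ⟨hs, hp⟩ := sum_pow_jump_le hK x
  set w := 1 + ∑ k, (x k : ℝ) ^ 6
  have hκ : 0 ≤ (2 * K) ^ 6 := by positivity
  have hw0 : 0 ≤ w := by linarith
  refine (abs_jumpSum_le M _ x).trans ((jumpSum_le hK
    (A := fun _ => C * (2 + 4 * (2 * K) ^ 6) * w) (fun _ => by positivity) ?_ ?_).trans ?_)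
  · intro i
    have h1 := (hf (jumpSite M i x)).trans (mul_le_mul_of_nonneg_left (hs i) hC)
    have h2 := hf x
    have h3 := abs_sub (f (jumpSite M i x)) (f x)
    have h4 : 0 ≤ C * ((2 * K) ^ 6 * w) := by positivity
    linarith
  · intro i j hij
    have h1 := (hf (jumpPair M i j x)).trans (mul_le_mul_of_nonneg_left (hp i j hij) hC)
    have h2 := hf x
    have h3 := abs_sub (f (jumpPair M i j x)) (f x)
    have h4 : 0 ≤ C * (2 + 4 * (2 * K) ^ 6) * w := by positivity
    linarith
  · simp only [Finset.sum_const, Finset.card_univ, Fintype.card_fin, nsmul_eq_mul]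
    apply le_of_eq; ring

theorem continuous_gen (M : Coeffs) {N : ℕ} {f : State N → ℝ} (hf : Continuous f) :
    Continuous (gen M f) := by
  have h1 := fun i : Fin N => hf.comp (continuous_jumpSite M i)
  have h2 := fun i j : Fin N => hf.comp (continuous_jumpPair M i j)
  simp only [Function.comp_def] at h1 h2
  unfold gen jumpSum
  refine Continuous.add ?_ (Continuous.mul continuous_const ?_)
  · exact continuous_finsetSum _ fun i _ => continuous_const.mul ((h1 i).sub hf)
  · exact continuous_finsetSum _ fun i _ => continuous_finsetSum _ fun j _ =>
      continuous_const.mul ((h2 i j).sub hf)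

theorem PolyGrowth.apply_gen {N : ℕ} {f : State N → ℝ} (hf : PolyGrowth f) (M : Coeffs) :
    PolyGrowth (gen M f) := by
  obtain ⟨K, hK⟩ := M.exists_boundedBy
  have hK0 : 0 ≤ K := zero_le_one.trans hK.one_le
  obtain ⟨hfc, C, hC, hf⟩ := hf
  exact ⟨continuous_gen M hfc, _, by positivity, abs_gen_le hK hC hf⟩

/-! ### Forward equation for functions of polynomial growth -/

/-- Truncation of a continuous function at the levels `± m`. -/
def clip {N : ℕ} {f : State N → ℝ} (hf : Continuous f) (m : ℕ) : State N →ᵇ ℝ :=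
  BoundedContinuousFunction.ofNormedAddCommGroup (fun x => max (-m : ℝ) (min (f x) m))
    (by fun_prop) m (fun x => by
      rw [Real.norm_eq_abs, abs_le]
      exact ⟨le_max_left _ _, max_le (by linarith [(Nat.cast_nonneg m : (0 : ℝ) ≤ m)])
        (min_le_right _ _)⟩)

theorem clip_apply {N : ℕ} {f : State N → ℝ} (hf : Continuous f) (m : ℕ) (x : State N) :
    clip hf m x = max (-m : ℝ) (min (f x) m) := rfl

theorem abs_clip_le {N : ℕ} {f : State N → ℝ} (hf : Continuous f) (m : ℕ) (x : State N) :
    |clip hf m x| ≤ |f x| := by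
  have hm : (0 : ℝ) ≤ m := Nat.cast_nonneg m
  rw [clip_apply, abs_le]
  constructor
  · refine le_max_of_le_right (le_min (neg_abs_le _) ?_)
    linarith [abs_nonneg (f x)]
  · exact max_le (by linarith [abs_nonneg (f x)]) ((min_le_left _ _).trans (le_abs_self _))

theorem tendsto_clip {N : ℕ} {f : State N → ℝ} (hf : Continuous f) (x : State N) :
    Tendsto (fun m => clip hf m x) atTop (𝓝 (f x)) := by
  refine tendsto_const_nhds.congr' ?_
  obtain ⟨n, hn⟩ := exists_nat_ge |f x|
  filter_upwards [eventually_ge_atTop n] with m hm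
  have h1 : |f x| ≤ m := hn.trans (by exact_mod_cast hm)
  rw [clip_apply, min_eq_left (abs_le.1 h1).2, max_eq_right (abs_le.1 h1).1]

theorem tendsto_gen_clip (M : Coeffs) {N : ℕ} {f : State N → ℝ} (hf : Continuous f)
    (x : State N) : Tendsto (fun m => gen M (clip hf m) x) atTop (𝓝 (gen M f x)) := by
  unfold gen jumpSum
  refine Tendsto.add ?_ (Tendsto.const_mul _ ?_)
  · exact tendsto_finsetSum _ fun i _ =>
      ((tendsto_clip hf _).sub (tendsto_clip hf _)).const_mul _
  · exact tendsto_finsetSum _ fun i _ => tendsto_finsetSum _ fun j _ =>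
      ((tendsto_clip hf _).sub (tendsto_clip hf _)).const_mul _

theorem expect_eq_expect_max {N : ℕ} {Ω : Type*} [MeasurableSpace Ω] {P : Measure Ω}
    {X : ℝ≥0 → Ω → State N} (f : State N → ℝ) (t : ℝ) :
    expect P X t f = expect P X (max t 0) f := by
  rcases le_total t 0 with h | h
  · simp [expect, Real.toNNReal_of_nonpos h, h]
  · rw [max_eq_left h]

section Dynkin

variable {M : Coeffs} {N : ℕ} {Ω : Type*} [MeasurableSpace Ω] {P : Measure Ω}
  [IsProbabilityMeasure P] {X : ℝ≥0 → Ω → State N}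

theorem integrable_weight (hX : IsLinearSystem M N P X)
    (h0 : ∀ᵐ ω ∂P, ∀ i, X 0 ω i = 0 ∨ X 0 ω i = 1) (t : ℝ) :
    Integrable (fun ω => 1 + ∑ k, (X t.toNNReal ω k : ℝ) ^ 6) P := by
  obtain ⟨K, hK⟩ := M.exists_boundedBy
  have := (moment_bound hK hX h0 6 (le_max_right t 0)).1
  rw [show (max t 0).toNNReal = t.toNNReal by
    rcases le_total t 0 with h | h <;> simp [h, Real.toNNReal_of_nonpos]] at this
  exact (integrable_const _).add this

theorem PolyGrowth.integrable {f : State N → ℝ} (hf : PolyGrowth f)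
    (hX : IsLinearSystem M N P X) (h0 : ∀ᵐ ω ∂P, ∀ i, X 0 ω i = 0 ∨ X 0 ω i = 1) (t : ℝ) :
    Integrable (fun ω => f (X t.toNNReal ω)) P := by
  obtain ⟨hfc, C, hC, hf⟩ := hf
  exact ((integrable_weight hX h0 t).const_mul C).mono'
    (hfc.measurable.comp (hX.measurable _)).aestronglyMeasurable
    (Eventually.of_forall fun ω => hf _)

theorem exists_expect_weight_le (hX : IsLinearSystem M N P X)
    (h0 : ∀ᵐ ω ∂P, ∀ i, X 0 ω i = 0 ∨ X 0 ω i = 1) (T : ℝ) :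
    ∃ B, 0 ≤ B ∧ ∀ t ≤ T, expect P X t (fun x => 1 + ∑ k, (x k : ℝ) ^ 6) ≤ B := by
  obtain ⟨K, hK⟩ := M.exists_boundedBy
  have hK0 : 0 ≤ K := zero_le_one.trans hK.one_le
  refine ⟨1 + N * Real.exp (6 * K * (2 * K) ^ 6 * max T 0), by positivity, fun t ht => ?_⟩
  rw [expect_eq_expect_max]
  obtain ⟨h1, h2⟩ := moment_bound hK hX h0 6 (le_max_right t 0)
  rw [expect, integral_add (integrable_const _) h1]
  simp only [integral_const, probReal_univ, smul_eq_mul, mul_one]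
  refine add_le_add le_rfl (h2.trans ?_)
  gcongr

theorem PolyGrowth.tendsto_expect_clip {f : State N → ℝ} (hf : PolyGrowth f)
    (hX : IsLinearSystem M N P X) (h0 : ∀ᵐ ω ∂P, ∀ i, X 0 ω i = 0 ∨ X 0 ω i = 1) (t : ℝ) :
    Tendsto (fun m => expect P X t (clip hf.1 m)) atTop (𝓝 (expect P X t f)) := by
  refine tendsto_integral_of_dominated_convergence (fun ω => |f (X t.toNNReal ω)|)
    (fun m => (integrable_bounded_comp (hX.measurable _) _).aestronglyMeasurable)
    (hf.integrable hX h0 t).abs (fun m => Eventually.of_forall fun ω => ?_)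
    (Eventually.of_forall fun ω => tendsto_clip hf.1 _)
  exact abs_clip_le hf.1 m _

theorem PolyGrowth.expect_sub_eq {f : State N → ℝ} (hf : PolyGrowth f)
    (hX : IsLinearSystem M N P X) (h0 : ∀ᵐ ω ∂P, ∀ i, X 0 ω i = 0 ∨ X 0 ω i = 1) {t : ℝ}
    (ht : 0 ≤ t) :
    IntervalIntegrable (fun s => expect P X s (gen M f)) volume 0 t ∧
      expect P X t f - expect P X 0 f = ∫ s in (0 : ℝ)..t, expect P X s (gen M f) := by
  obtain ⟨K, hK⟩ := M.exists_boundedBy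
  have hK0 : 0 ≤ K := zero_le_one.trans hK.one_le
  obtain ⟨C, hC, hfC⟩ := hf.2
  obtain ⟨B, hB, hWB⟩ := exists_expect_weight_le hX h0 t
  set D := 3 * K * N * (C * (2 + 4 * (2 * K) ^ 6)) with hD
  have hD0 : 0 ≤ D := by positivity
  -- Clipping does not increase |f|, so one multiple of the weight dominates the generator of every
  -- clipped function. This drives dominated convergence, first in ω and then in s.
  have hclip : ∀ m x, |gen M (clip hf.1 m) x| ≤ D * (1 + ∑ k, (x k : ℝ) ^ 6) := fun m =>
    abs_gen_le hK hC fun x => (abs_clip_le hf.1 m x).trans (hfC x)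
  have hcont : ∀ m, Continuous fun s => expect P X s (gen M (clip hf.1 m)) := fun m => by
    have := hX.continuous_expect_bounded (generator M N (clip hf.1 m))
    simpa only [expect, generator_eq_gen] using this
  have hlim : ∀ s, Tendsto (fun m => expect P X s (gen M (clip hf.1 m))) atTop
      (𝓝 (expect P X s (gen M f))) := fun s => by
    refine tendsto_integral_of_dominated_convergence
      (fun ω => D * (1 + ∑ k, (X s.toNNReal ω k : ℝ) ^ 6)) (fun m => ?_)
      ((integrable_weight hX h0 s).const_mul D)
      (fun m => Eventually.of_forall fun ω => hclip m _)
      (Eventually.of_forall fun ω => tendsto_gen_clip M hf.1 _)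
    exact ((continuous_gen M (clip hf.1 m).continuous).measurable.comp
      (hX.measurable _)).aestronglyMeasurable
  have hbd : ∀ m, ∀ s ≤ t, |expect P X s (gen M (clip hf.1 m))| ≤ D * B := fun m s hs => by
    refine (abs_integral_le_integral_abs).trans ?_
    refine (integral_mono_of_nonneg (Eventually.of_forall fun ω => abs_nonneg _)
      ((integrable_weight hX h0 s).const_mul D)
      (Eventually.of_forall fun ω => hclip m _)).trans ?_
    rw [integral_const_mul]
    exact mul_le_mul_of_nonneg_left (hWB s hs) hD0
  have hmeas : Measurable fun s => expect P X s (gen M f) :=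
    measurable_of_tendsto_metrizable (fun m => (hcont m).measurable) (tendsto_pi_nhds.2 hlim)
  have hIoc : ∀ s ∈ Set.uIoc 0 t, s ≤ t := fun s hs => by
    rw [Set.uIoc_of_le ht] at hs; exact hs.2
  constructor
  · refine (intervalIntegrable_const (c := D * B)).mono_fun' hmeas.aestronglyMeasurable ?_
    refine (ae_restrict_iff' measurableSet_uIoc).2 (Eventually.of_forall fun s hs => ?_)
    exact le_of_tendsto' (hlim s).abs fun m => hbd m s (hIoc s hs)
  · refine tendsto_nhds_unique ((hf.tendsto_expect_clip hX h0 t).sub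
      (hf.tendsto_expect_clip hX h0 0)) ?_
    simp_rw [hX.expect_sub_eq_bounded _ ht]
    refine intervalIntegral.tendsto_integral_filter_of_dominated_convergence (fun _ => D * B)
      (Eventually.of_forall fun m => (hcont m).aestronglyMeasurable)
      (Eventually.of_forall fun m => Eventually.of_forall fun s hs => hbd m s (hIoc s hs))
      intervalIntegrable_const (Eventually.of_forall fun s _ => hlim s)

theorem PolyGrowth.continuous_expect {f : State N → ℝ} (hf : PolyGrowth f)
    (hX : IsLinearSystem M N P X) (h0 : ∀ᵐ ω ∂P, ∀ i, X 0 ω i = 0 ∨ X 0 ω i = 1) :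
    Continuous fun t => expect P X t f := by
  have hint : ∀ a b, IntervalIntegrable
      (fun s => expect P X s (gen M f)) volume a b := by
    -- For negative endpoints the integrand is constant, by the convention of `expect`.
    have h : ∀ t, IntervalIntegrable (fun s => expect P X s (gen M f)) volume 0 t := by
      intro t
      rcases le_total 0 t with ht | ht
      · exact (hf.expect_sub_eq hX h0 ht).1
      · refine (intervalIntegrable_const (c := expect P X 0 (gen M f))).congr fun s hs => ?_
        rw [Set.uIoc_of_ge ht] at hs
        rw [expect_eq_expect_max _ s, max_eq_right hs.2]
    exact fun a b => (h a).symm.trans (h b)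
  have h1 := (intervalIntegral.continuous_primitive hint 0).comp
    (by fun_prop : Continuous fun t : ℝ => max t 0)
  have h2 : (fun t => expect P X t f) = fun t =>
      expect P X 0 f + ∫ s in (0 : ℝ)..(max t 0), expect P X s (gen M f) := by
    ext t
    rw [← (hf.expect_sub_eq hX h0 (le_max_right t 0)).2, expect_eq_expect_max f t]
    ring
  rw [h2]
  exact continuous_const.add h1

/-- The class `PolyGrowth` is stable under the generator, so s ↦ E(Lf) is continuous and the
integrated forward equation can be differentiated. -/
theorem PolyGrowth.hasDerivAt_expect {f : State N → ℝ} (hf : PolyGrowth f)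
    (hX : IsLinearSystem M N P X) (h0 : ∀ᵐ ω ∂P, ∀ i, X 0 ω i = 0 ∨ X 0 ω i = 1) {t : ℝ}
    (ht : 0 < t) :
    HasDerivAt (fun s => expect P X s f) (expect P X t (gen M f)) t := by
  have hc := (hf.apply_gen M).continuous_expect hX h0
  have h1 := (intervalIntegral.integral_hasDerivAt_right (hc.intervalIntegrable 0 t)
    (hc.stronglyMeasurableAtFilter _ _) hc.continuousAt).const_add (expect P X 0 f)
  refine h1.congr_of_eventuallyEq ?_
  filter_upwards [lt_mem_nhds ht] with s hs
  rw [← (hf.expect_sub_eq hX h0 hs.le).2]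
  ring

end Dynkin

/-! ### Second moments of time-dependent observables -/

theorem gen_add (M : Coeffs) {N : ℕ} (f g : State N → ℝ) (x : State N) :
    gen M (fun y => f y + g y) x = gen M f x + gen M g x := by
  unfold gen
  rw [← jumpSum_add]
  congr 1
  ext y
  ring

theorem gen_const_mul (M : Coeffs) {N : ℕ} (r : ℝ) (f : State N → ℝ) (x : State N) :
    gen M (fun y => r * f y) x = r * gen M f x := by
  unfold gen
  rw [← jumpSum_const_mul]
  congr 1
  ext y
  ring

theorem gen_sum (M : Coeffs) {N : ℕ} {ι : Type*} (s : Finset ι) (f : ι → State N → ℝ)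
    (x : State N) : gen M (fun y => ∑ a ∈ s, f a y) x = ∑ a ∈ s, gen M (f a) x := by
  classical
  induction s using Finset.induction_on with
  | empty => simp [gen, jumpSum]
  | insert a s ha ih =>
    simp only [Finset.sum_insert ha]
    rw [gen_add, ih]

/-- The carré du champ operator. -/
def gam (M : Coeffs) {N : ℕ} (f : State N → ℝ) (x : State N) : ℝ :=
  jumpSum M (fun y => (f y - f x) ^ 2) x

/-- The identity b² - a² = 2a(b - a) + (b - a)², summed over all jumps. -/
theorem gen_sq (M : Coeffs) {N : ℕ} (f : State N → ℝ) (x : State N) :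
    gen M (fun y => f y ^ 2) x = 2 * f x * gen M f x + gam M f x := by
  unfold gen gam
  rw [← jumpSum_const_mul, ← jumpSum_add]
  congr 1
  ext y
  ring

theorem sum_mul_sq {ι : Type*} [Fintype ι] (u v : ι → ℝ) :
    (∑ a, u a * v a) ^ 2 = ∑ a, ∑ b, u a * u b * (v a * v b) := by
  rw [sq, Finset.sum_mul_sum]
  exact Finset.sum_congr rfl fun a _ => Finset.sum_congr rfl fun b _ => by ring

section SecondMoment

variable {M : Coeffs} {N : ℕ} {Ω : Type*} [MeasurableSpace Ω] {P : Measure Ω}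
  [IsProbabilityMeasure P] {X : ℝ≥0 → Ω → State N}

theorem expect_sum_sum (hX : IsLinearSystem M N P X)
    (h0 : ∀ᵐ ω ∂P, ∀ i, X 0 ω i = 0 ∨ X 0 ω i = 1) {ι : Type*} [Fintype ι]
    {ψ : ι → ι → State N → ℝ} (hψ : ∀ a b, PolyGrowth (ψ a b)) (r : ι → ι → ℝ) (s : ℝ) :
    expect P X s (fun x => ∑ a, ∑ b, r a b * ψ a b x) =
      ∑ a, ∑ b, r a b * expect P X s (ψ a b) := by
  unfold expect
  rw [integral_finsetSum _ fun a _ => integrable_finsetSum _ fun b _ =>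
    ((hψ a b).integrable hX h0 s).const_mul _]
  refine Finset.sum_congr rfl fun a _ => ?_
  rw [integral_finsetSum _ fun b _ => ((hψ a b).integrable hX h0 s).const_mul _]
  exact Finset.sum_congr rfl fun b _ => integral_const_mul _ _

/-- For Z_s = ∑ α s a φ_a with total drift D and carré du champ Γ, (d/ds) E Z² = E(2ZD + Γ). The
inequality 2ZD ≤ Z² + D² closes the estimate, and Gronwall applies with rate 1. Only an upper bound
`B` for D² + Γ is needed; its polynomial growth ensures integrability. -/
theorem second_moment_le (hX : IsLinearSystem M N P X)
    (h0 : ∀ᵐ ω ∂P, ∀ i, X 0 ω i = 0 ∨ X 0 ω i = 1) {ι : Type*} [Fintype ι]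
    {φ : ι → State N → ℝ} (hφ : ∀ a b, PolyGrowth (fun x => φ a x * φ b x))
    {α α' : ℝ → ι → ℝ} (hα : ∀ a s, HasDerivAt (fun s => α s a) (α' s a) s) {t η : ℝ}
    (ht : 0 ≤ t) (hη : 0 ≤ η) {B : ℝ → State N → ℝ} (hBg : ∀ s, PolyGrowth (B s))
    (hB : ∀ s ∈ Set.Ioo 0 t, ∀ x, (∑ a, α' s a * φ a x + gen M (fun y => ∑ a, α s a * φ a y) x) ^ 2
      + gam M (fun y => ∑ a, α s a * φ a y) x ≤ B s x)
    (hBη : ∀ s ∈ Set.Ioo 0 t, expect P X s (B s) ≤ η) :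
    expect P X t (fun x => (∑ a, α t a * φ a x) ^ 2) ≤
      Real.exp t * (expect P X 0 (fun x => (∑ a, α 0 a * φ a x) ^ 2) + η * t) := by
  -- Expanding the square separates time from state: smooth coefficients α s a α s b multiply
  -- expectations of fixed functions, so the product rule and the time-independent forward equation
  -- suffice.
  have hsq : ∀ s r, expect P X r (fun x => (∑ a, α s a * φ a x) ^ 2) =
      ∑ a, ∑ b, α s a * α s b * expect P X r (fun x => φ a x * φ b x) := by
    intro s r
    rw [← expect_sum_sum hX h0 hφ (fun a b => α s a * α s b)]
    congr 1
    ext x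
    exact sum_mul_sq _ _
  have hsqg : ∀ s, PolyGrowth (fun x => (∑ a, α s a * φ a x) ^ 2) := by
    intro s
    simp_rw [sum_mul_sq]
    exact PolyGrowth.sum _ fun a _ => PolyGrowth.sum _ fun b _ => (hφ a b).const_mul _
  have hder : ∀ s ∈ Set.Ioo 0 t, HasDerivAt
      (fun s => expect P X s (fun x => (∑ a, α s a * φ a x) ^ 2))
      (expect P X s (fun x => ∑ a, ∑ b, (α' s a * α s b + α s a * α' s b) * (φ a x * φ b x)) +
        expect P X s (fun x => ∑ a, ∑ b, α s a * α s b * gen M (fun y => φ a y * φ b y) x)) s := by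
    intro s hs
    simp_rw [hsq]
    rw [expect_sum_sum hX h0 hφ, expect_sum_sum hX h0 fun a b => (hφ a b).apply_gen M,
      ← Finset.sum_add_distrib]
    simp_rw [← Finset.sum_add_distrib]
    exact HasDerivAt.fun_sum fun a _ => HasDerivAt.fun_sum fun b _ =>
      ((hα a s).mul (hα b s)).mul ((hφ a b).hasDerivAt_expect hX h0 hs.1)
  have hcont : Continuous fun s => expect P X s (fun x => (∑ a, α s a * φ a x) ^ 2) := by
    have hαc : ∀ a, Continuous fun s => α s a := fun a =>
      continuous_iff_continuousAt.2 fun s => (hα a s).continuousAt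
    simp_rw [hsq]
    exact continuous_finsetSum _ fun a _ => continuous_finsetSum _ fun b _ =>
      ((hαc a).mul (hαc b)).mul ((hφ a b).continuous_expect hX h0)
  have key := gronwall_of_deriv_le (C := 1) ht zero_le_one hη hcont.continuousOn hder ?_
  · simpa using key
  intro s hs
  have hg1 : PolyGrowth fun x =>
      ∑ a, ∑ b, (α' s a * α s b + α s a * α' s b) * (φ a x * φ b x) :=
    PolyGrowth.sum _ fun a _ => PolyGrowth.sum _ fun b _ => (hφ a b).const_mul _
  have hg2 : PolyGrowth fun x =>
      ∑ a, ∑ b, α s a * α s b * gen M (fun y => φ a y * φ b y) x :=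
    PolyGrowth.sum _ fun a _ => PolyGrowth.sum _ fun b _ => ((hφ a b).apply_gen M).const_mul _
  have hpt : ∀ x, ∑ a, ∑ b, (α' s a * α s b + α s a * α' s b) * (φ a x * φ b x) +
      ∑ a, ∑ b, α s a * α s b * gen M (fun y => φ a y * φ b y) x ≤
      (∑ a, α s a * φ a x) ^ 2 + B s x := by
    intro x
    have e1 : ∑ a, ∑ b, (α' s a * α s b + α s a * α' s b) * (φ a x * φ b x) =
        2 * (∑ a, α s a * φ a x) * ∑ a, α' s a * φ a x := by
      have l : (∑ a, α' s a * φ a x) * (∑ b, α s b * φ b x) =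
          ∑ a, ∑ b, α' s a * φ a x * (α s b * φ b x) := Finset.sum_mul_sum _ _ _ _
      have r : (∑ a, α s a * φ a x) * (∑ b, α' s b * φ b x) =
          ∑ a, ∑ b, α s a * φ a x * (α' s b * φ b x) := Finset.sum_mul_sum _ _ _ _
      have e : 2 * (∑ a, α s a * φ a x) * ∑ a, α' s a * φ a x =
          (∑ a, α' s a * φ a x) * (∑ b, α s b * φ b x) +
          (∑ a, α s a * φ a x) * (∑ b, α' s b * φ b x) := by ring
      rw [e, l, r, ← Finset.sum_add_distrib]
      simp_rw [← Finset.sum_add_distrib]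
      exact Finset.sum_congr rfl fun a _ => Finset.sum_congr rfl fun b _ => by ring
    have e2 : ∑ a, ∑ b, α s a * α s b * gen M (fun y => φ a y * φ b y) x =
        gen M (fun y => (∑ a, α s a * φ a y) ^ 2) x := by
      simp_rw [sum_mul_sq, gen_sum, gen_const_mul]
    rw [e1, e2, gen_sq]
    have := hB s hs x
    nlinarith [sq_nonneg (∑ a, α s a * φ a x -
      (∑ a, α' s a * φ a x + gen M (fun y => ∑ a, α s a * φ a y) x))]
  have h1 : expect P X s (fun x => ∑ a, ∑ b, (α' s a * α s b + α s a * α' s b) * (φ a x * φ b x)) +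
      expect P X s (fun x => ∑ a, ∑ b, α s a * α s b * gen M (fun y => φ a y * φ b y) x) ≤
      expect P X s (fun x => (∑ a, α s a * φ a x) ^ 2) + expect P X s (B s) := by
    unfold expect
    rw [← integral_add (hg1.integrable hX h0 s) (hg2.integrable hX h0 s),
      ← integral_add ((hsqg s).integrable hX h0 s) ((hBg s).integrable hX h0 s)]
    exact integral_mono ((hg1.add hg2).integrable hX h0 s)
      (((hsqg s).add (hBg s)).integrable hX h0 s) fun ω => hpt _
  rw [one_mul]
  exact h1.trans (add_le_add le_rfl (hBη s hs))

end SecondMoment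

/-! ### Riemann sums -/

/-- The Riemann sum `(1/N) ∑ᵢ f(i/N)`. -/
def riemann (N : ℕ) (f : C(I, ℝ)) : ℝ := (1 / N : ℝ) * ∑ i : Fin N, f (pos i)

theorem riemann_sub (N : ℕ) (f g : C(I, ℝ)) : riemann N (f - g) = riemann N f - riemann N g := by
  simp [riemann, mul_sub]

/-- Averages over `Fin N`. -/
theorem average_le {N : ℕ} {a : Fin N → ℝ} {B : ℝ} (hB : 0 ≤ B) (h : ∀ i, a i ≤ B) :
    (1 / N : ℝ) * ∑ i, a i ≤ B := by
  rcases Nat.eq_zero_or_pos N with rfl | hN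
  · simpa using hB
  have hN' : (0 : ℝ) < N := by exact_mod_cast hN
  calc (1 / N : ℝ) * ∑ i, a i ≤ (1 / N : ℝ) * ∑ i : Fin N, B := by
        gcongr with i; exact h i
    _ = B := by simp; field_simp

theorem abs_riemann_le (N : ℕ) (f : C(I, ℝ)) : |riemann N f| ≤ ‖f‖ := by
  rw [riemann, abs_mul, abs_of_nonneg (by positivity : (0 : ℝ) ≤ 1 / N)]
  refine le_trans ?_ (average_le (a := fun i : Fin N => |f (pos i)|) (norm_nonneg f)
    fun i => f.norm_coe_le_norm _)
  gcongr
  exact Finset.abs_sum_le_sum_abs _ _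

theorem integral_I_eq (f : C(I, ℝ)) :
    ∫ u, f u = ∫ x in (0 : ℝ)..1, f (Set.projIcc 0 1 zero_le_one x) := by
  rw [intervalIntegral.integral_of_le zero_le_one, ← integral_Icc_eq_integral_Ioc,
    ← integral_subtype measurableSet_Icc]
  simp

theorem tendsto_riemann (f : C(I, ℝ)) : Tendsto (fun N => riemann N f) atTop (𝓝 (∫ u, f u)) := by
  rw [Metric.tendsto_atTop]
  intro ε hε
  have huc : UniformContinuous f := CompactSpace.uniformContinuous_of_continuous f.continuous
  obtain ⟨δ, hδ, hfδ⟩ := Metric.uniformContinuous_iff.1 huc (ε / 2) (half_pos hε)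
  obtain ⟨n, hn⟩ := exists_nat_gt (1 / δ)
  refine ⟨n + 1, fun N hN => ?_⟩
  have hN0 : (0 : ℝ) < N := by exact_mod_cast (by omega : 0 < N)
  have hNδ : 1 / (N : ℝ) < δ := by
    rw [div_lt_comm₀ hN0 hδ]
    exact hn.trans_le (by exact_mod_cast (by omega : n ≤ N))
  set g : ℝ → ℝ := fun x => f (Set.projIcc 0 1 zero_le_one x) with hg
  have hgc : Continuous g := f.continuous.comp continuous_projIcc
  -- The point `pos i` is (i + 1)/N, the right endpoint of the i-th cell since `Fin N` starts at 0;
  -- uniform continuity is then used on each cell.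
  have hsplit : ∫ u, f u = ∑ i : Fin N, ∫ x in ((i : ℝ) / N)..(((i : ℝ) + 1) / N), g x := by
    rw [integral_I_eq, Finset.sum_range
      (fun k : ℕ => ∫ x in ((k : ℝ) / N)..(((k : ℝ) + 1) / N), g x) |>.symm]
    have := intervalIntegral.sum_integral_adjacent_intervals (f := g) (μ := volume)
      (a := fun k : ℕ => (k : ℝ) / N) (n := N) fun k _ => hgc.intervalIntegrable _ _
    push_cast at this
    rw [this]
    simp [hN0.ne', hg]
  have hpiece : ∀ i : Fin N, |(1 / N : ℝ) * f (pos i) -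
      ∫ x in ((i : ℝ) / N)..(((i : ℝ) + 1) / N), g x| ≤ (1 / N : ℝ) * (ε / 2) := by
    intro i
    have hlen : ((i : ℝ) + 1) / N - (i : ℝ) / N = 1 / N := by ring
    have hle : (i : ℝ) / N ≤ ((i : ℝ) + 1) / N := by gcongr; linarith
    have hi1 : ((i : ℝ) + 1) / N ≤ 1 := (pos i).2.2
    have hi0 : 0 ≤ (i : ℝ) / N := by positivity
    have h1 : (1 / N : ℝ) * f (pos i) =
        ∫ x in ((i : ℝ) / N)..(((i : ℝ) + 1) / N), f (pos i) := by
      rw [intervalIntegral.integral_const, hlen, smul_eq_mul]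
    rw [h1, ← intervalIntegral.integral_sub (by simp) (hgc.intervalIntegrable _ _)]
    have := intervalIntegral.norm_integral_le_of_norm_le_const (C := ε / 2)
      (f := fun x => f (pos i) - g x) (a := (i : ℝ) / N) (b := ((i : ℝ) + 1) / N) ?_
    · rw [hlen, abs_of_pos (by positivity), Real.norm_eq_abs] at this
      linarith
    · intro x hx
      rw [Set.uIoc_of_le hle] at hx
      have hxI : x ∈ Set.Icc (0 : ℝ) 1 := ⟨hi0.trans hx.1.le, hx.2.trans hi1⟩
      have h2 : g x = f ⟨x, hxI⟩ := by rw [hg]; simp only [Set.projIcc_of_mem _ hxI]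
      rw [h2, Real.norm_eq_abs, ← Real.dist_eq]
      refine (hfδ ?_).le
      rw [Subtype.dist_eq, Real.dist_eq]
      change |((i : ℝ) + 1) / N - x| < δ
      rw [abs_of_nonneg (by linarith [hx.2])]
      linarith [hx.1]
  rw [Real.dist_eq, hsplit, riemann, Finset.mul_sum, ← Finset.sum_sub_distrib]
  calc _ ≤ ∑ i : Fin N, (1 / N : ℝ) * (ε / 2) :=
        (Finset.abs_sum_le_sum_abs _ _).trans (Finset.sum_le_sum fun i _ => hpiece i)
    _ = ε / 2 := by simp; field_simp
    _ < ε := half_lt_self hε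

/-- Riemann sums and the integral are both 1-Lipschitz for the supremum norm, so convergence on a
finite ε/3-net gives uniform convergence on a compact set. -/
theorem riemann_uniform {S : Set C(I, ℝ)} (hS : IsCompact S) {ε : ℝ} (hε : 0 < ε) :
    ∀ᶠ N in atTop, ∀ f ∈ S, |riemann N f - ∫ u, f u| ≤ ε := by
  obtain ⟨t, -, htf, hcover⟩ := hS.finite_cover_balls (e := ε / 3) (by positivity)
  have h1 : ∀ᶠ N in atTop, ∀ g ∈ t, |riemann N g - ∫ u, g u| ≤ ε / 3 := by
    rw [eventually_all_finite htf]
    intro g _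
    filter_upwards [Metric.tendsto_nhds.1 (tendsto_riemann g) (ε / 3) (by positivity)] with N hN
    exact hN.le
  filter_upwards [h1] with N hN f hf
  obtain ⟨g, hg, hfg⟩ := Set.mem_iUnion₂.1 (hcover hf)
  rw [Metric.mem_ball, dist_eq_norm] at hfg
  have h2 := abs_riemann_le N (f - g)
  have h3 := abs_integral_C_le (f - g)
  rw [riemann_sub] at h2
  have h4 : ∫ u, (f - g) u = (∫ u, f u) - ∫ u, g u :=
    integral_sub (integrable_C f) (integrable_C g)
  rw [h4] at h3
  have h5 := hN g hg
  rw [abs_le] at *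
  constructor <;> linarith [h2.1, h2.2, h3.1, h3.2, h5.1, h5.2]

/-! ### The limiting operators -/

theorem kernelOp_add (k k' : C(I × I, ℝ)) : kernelOp (k + k') = kernelOp k + kernelOp k' := by
  ext f u
  have := integral_add (integrable_C (k.curry u * f)) (integrable_C (k'.curry u * f))
  simpa [kernelOp_apply, add_mul] using this

theorem mulOp_add (g g' : C(I, ℝ)) : mulOp (g + g') = mulOp g + mulOp g' := map_add _ _ _

theorem mulOp_apply (g f : C(I, ℝ)) : mulOp g f = g * f := rfl

theorem swapK_swapK (k : C(I × I, ℝ)) : swapK (swapK k) = k := by ext ⟨u, v⟩; rfl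

theorem swapK_add (k k' : C(I × I, ℝ)) : swapK (k + k') = swapK k + swapK k' := rfl

/-- The operator `f ↦ m f + f ∫ q(·, v) dv + ∫ κ(·, v) f(v) dv`. -/
def genOp (m : C(I, ℝ)) (q κ : C(I × I, ℝ)) : C(I, ℝ) →L[ℝ] C(I, ℝ) :=
  mulOp (m + kernelOp q 1) + kernelOp κ

theorem integral_mul_kernelOp (k : C(I × I, ℝ)) (f g : C(I, ℝ)) :
    ∫ u, f u * kernelOp k g u = ∫ u, kernelOp (swapK k) f u * g u := by
  simp only [kernelOp_apply, ← integral_const_mul, ← integral_mul_const]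
  rw [integral_integral_swap]
  · refine integral_congr_ae (Eventually.of_forall fun v => integral_congr_ae
      (Eventually.of_forall fun u => ?_))
    simp only [swapK, ContinuousMap.comp_apply, ContinuousMap.coe_mk, Prod.swap_prod_mk]
    ring
  · have : Continuous (Function.uncurry fun u v : I => f u * (k (u, v) * g v)) := by
      unfold Function.uncurry; fun_prop
    exact this.integrable_of_hasCompactSupport (HasCompactSupport.of_compactSpace _)

/-- The multiplication part is its own transpose; by Fubini the integral operator is transposed by
swapping the arguments of its kernel. -/
theorem densityFunctional_genOp (m : C(I, ℝ)) (q κ : C(I × I, ℝ)) (r f : C(I, ℝ)) :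
    densityFunctional r (genOp m q κ f) = densityFunctional (genOp m q (swapK κ) r) f := by
  have e1 : densityFunctional r (genOp m q κ f) =
      densityFunctional r ((m + kernelOp q 1) * f) + densityFunctional r (kernelOp κ f) := by
    rw [← map_add]; rfl
  have e2 : densityFunctional (genOp m q (swapK κ) r) f =
      densityFunctional ((m + kernelOp q 1) * r) f +
        densityFunctional (kernelOp (swapK κ) r) f := by
    simp only [densityFunctional, genOp, ContinuousLinearMap.comp_apply, mulOp_apply,
      add_apply, add_mul, map_add]
  rw [e1, e2]
  congr 1
  · rw [densityFunctional_apply, densityFunctional_apply]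
    refine integral_congr_ae (Eventually.of_forall fun u => ?_)
    simp only [ContinuousMap.mul_apply]
    ring
  · exact integral_mul_kernelOp κ r f

/-- The multiplication part of the drift of the `p`-th powers. -/
def driftMul (M : Coeffs) (p : ℕ) : C(I, ℝ) := (toR M.c ^ p - 1) * toR M.b

/-- The potential in the drift of the `p`-th powers. -/
def driftPot (M : Coeffs) (p : ℕ) : C(I × I, ℝ) :=
  toR M.lam * (toR M.a₁ ^ p - 1) + swapK (toR M.lam * (toR M.a₄ ^ p - 1))

/-- The kernel in the drift of the `p`-th powers. -/
def driftKer (M : Coeffs) (p : ℕ) : C(I × I, ℝ) :=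
  swapK (toR M.lam * toR M.a₂ ^ p) + toR M.lam * toR M.a₃ ^ p

/-- The operator describing the (diagonal part of the) drift of the `p`-th powers. -/
def driftOp (M : Coeffs) (p : ℕ) : C(I, ℝ) →L[ℝ] C(I, ℝ) :=
  genOp (driftMul M p) (driftPot M p) (driftKer M p)

/-- The operator on densities which is dual to `driftOp`. -/
def driftOpDual (M : Coeffs) (p : ℕ) : C(I, ℝ) →L[ℝ] C(I, ℝ) :=
  genOp (driftMul M p) (driftPot M p) (swapK (driftKer M p))

theorem densityFunctional_driftOp (M : Coeffs) (p : ℕ) (r f : C(I, ℝ)) :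
    densityFunctional r (driftOp M p f) = densityFunctional (driftOpDual M p r) f :=
  densityFunctional_genOp _ _ _ _ _

theorem driftOp_two (M : Coeffs) : driftOp M 2 = P₂ M := by
  simp only [driftOp, genOp, driftMul, driftPot, driftKer, P₂, P₃, P₄, P₅, P₆, P₇, mulOp_add,
    kernelOp_add, add_apply]
  abel

/-- Identifies ρ as the density to which the general scheme leads for p = 1; `driftOp_two` plays the
matching role for θ. -/
theorem driftOpDual_one (M : Coeffs) : driftOpDual M 1 = hydroOp M := by
  simp only [driftOpDual, genOp, driftMul, driftPot, driftKer, hydroOp, mulOp_add,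
    kernelOp_add, add_apply, pow_one, swapK_add, swapK_swapK]
  rw [mul_comm (toR M.b)]
  abel

/-- The kernel of the interaction term in the drift of the squares. -/
def crossKer (M : Coeffs) : C(I × I, ℝ) :=
  toR M.a₁ * toR M.a₂ * toR M.lam + swapK (toR M.lam * toR M.a₃ * toR M.a₄)

theorem densityFunctional_add (g g' : C(I, ℝ)) :
    densityFunctional (g + g') = densityFunctional g + densityFunctional g' := by
  simp only [densityFunctional, mulOp_add, ContinuousLinearMap.comp_add]

theorem lOne_eq (M : Coeffs) (r : C(I, ℝ)) :
    lOne M r = (2 : ℝ) • densityFunctional (r * kernelOp (crossKer M) r) := by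
  rw [lOne, crossKer, kernelOp_add, ← smul_add, ← densityFunctional_add, add_apply, mul_add]

/-! ### Exponentials and linear evolution equations -/

theorem opExp_zero_smul {E : Type*} [NormedAddCommGroup E] [NormedSpace ℝ E] (A : E →L[ℝ] E)
    (f : E) : opExp ((0 : ℝ) • A) f = f := by
  simp [opExp]

section Exponential

variable {E : Type*} [NormedAddCommGroup E] [NormedSpace ℝ E] [CompleteSpace E]

theorem hasDerivAt_opExp_apply' (A : E →L[ℝ] E) (f : E) (t : ℝ) :
    HasDerivAt (fun s : ℝ => opExp (s • A) f) (A (opExp (t • A) f)) t := by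
  simpa [opExp] using
    (hasDerivAt_exp_smul_const' (𝕂 := ℝ) A t).clm_apply (hasDerivAt_const t f)

theorem continuous_opExp_smul (A : E →L[ℝ] E) : Continuous fun s : ℝ => opExp (s • A) :=
  continuous_iff_continuousAt.2 fun t =>
    (hasDerivAt_exp_smul_const (𝕂 := ℝ) A t).continuousAt

theorem continuous_opExp_apply (A : E →L[ℝ] E) :
    Continuous fun z : ℝ × E => opExp (z.1 • A) z.2 :=
  ((continuous_opExp_smul A).comp continuous_fst).clm_apply continuous_snd

theorem opExp_smul_neg_smul (A : E →L[ℝ] E) (t : ℝ) (f : E) :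
    opExp (t • A) (opExp ((-t) • A) f) = f := by
  let : NormedAlgebra ℚ (E →L[ℝ] E) := .restrictScalars ℚ ℝ _
  have h1 : opExp (t • A) * opExp ((-t) • A) = 1 := by
    rw [opExp, opExp, ← NormedSpace.exp_add_of_commute]
    · simp
    · exact ((Commute.refl A).smul_left t).smul_right (-t)
  calc opExp (t • A) (opExp ((-t) • A) f) = (opExp (t • A) * opExp ((-t) • A)) f := rfl
    _ = f := by rw [h1]; rfl

/-- Supplies the backward test functions whose time derivative cancels the linear drift of the
empirical averages. -/
theorem hasDerivAt_opExp_backward (A : E →L[ℝ] E) (f : E) (t s : ℝ) :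
    HasDerivAt (fun s : ℝ => opExp ((t - s) • A) f) (-(A (opExp ((t - s) • A) f))) s := by
  have := (hasDerivAt_opExp_apply' A f (t - s)).scomp s ((hasDerivAt_id s).const_sub t)
  simpa [Function.comp_def] using this

/-- The inhomogeneous linear equation has a global solution. -/
theorem exists_inhomogeneous_solution (A : E →L[ℝ] E) (x₀ : E) {g : ℝ → E} (hg : Continuous g) :
    ∃ y : ℝ → E, y 0 = x₀ ∧ ∀ t, HasDerivAt y (A (y t) + g t) t := by
  have hc : Continuous fun s => opExp ((-s) • A) (g s) :=
    (continuous_opExp_apply A).comp (continuous_neg.prodMk hg)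
  refine ⟨fun t => opExp (t • A) (x₀ + ∫ s in (0 : ℝ)..t, opExp ((-s) • A) (g s)), ?_,
    fun t => ?_⟩
  · simp only [intervalIntegral.integral_same, add_zero]
    exact opExp_zero_smul A x₀
  · have h1 := (intervalIntegral.integral_hasDerivAt_right (hc.intervalIntegrable 0 t)
      (hc.stronglyMeasurableAtFilter _ _) hc.continuousAt).const_add x₀
    have h2 := (hasDerivAt_exp_smul_const' (𝕂 := ℝ) A t).clm_apply h1
    have h3 : NormedSpace.exp (t • A) (opExp ((-t) • A) (g t)) = g t :=
      opExp_smul_neg_smul A t (g t)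
    rw [h3] at h2
    exact h2

end Exponential

/-! ### Empirical measures of powers -/

/-- The integral of `f` against `(1/N) ∑ᵢ x(i)ᵖ δ_{i/N}`. -/
def powEmp {N : ℕ} (p : ℕ) (f : C(I, ℝ)) (x : State N) : ℝ :=
  (1 / N : ℝ) * ∑ k, (x k : ℝ) ^ p * f (pos k)

theorem powEmp_eq_sum {N : ℕ} (p : ℕ) (f : C(I, ℝ)) (x : State N) :
    powEmp p f x = ∑ k, (1 / N : ℝ) * f (pos k) * (x k : ℝ) ^ p := by
  rw [powEmp, Finset.mul_sum]
  exact Finset.sum_congr rfl fun k _ => by ring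

theorem powEmp_one_nonneg {N : ℕ} (p : ℕ) (x : State N) : 0 ≤ powEmp p 1 x := by
  unfold powEmp
  simp only [ContinuousMap.one_apply, mul_one]
  positivity

theorem powEmp_one_eq {N : ℕ} (p : ℕ) (x : State N) :
    powEmp p 1 x = (1 / N : ℝ) * ∑ k, (x k : ℝ) ^ p := by
  simp [powEmp]

theorem abs_weighted_powEmp_le {N : ℕ} (p : ℕ) {a : Fin N → ℝ} {R : ℝ} (ha : ∀ k, |a k| ≤ R)
    (x : State N) : |(1 / N : ℝ) * ∑ k, (x k : ℝ) ^ p * a k| ≤ R * powEmp p 1 x := by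
  rw [powEmp_one_eq, abs_mul, abs_of_nonneg (by positivity : (0 : ℝ) ≤ 1 / N), mul_left_comm]
  gcongr
  rw [Finset.mul_sum]
  refine (Finset.abs_sum_le_sum_abs _ _).trans (Finset.sum_le_sum fun k _ => ?_)
  rw [abs_mul, abs_of_nonneg (by positivity), mul_comm]
  exact mul_le_mul_of_nonneg_right (ha k) (by positivity)

theorem abs_powEmp_le {N : ℕ} (p : ℕ) (f : C(I, ℝ)) (x : State N) :
    |powEmp p f x| ≤ ‖f‖ * powEmp p 1 x :=
  abs_weighted_powEmp_le p (fun k => f.norm_coe_le_norm (pos k)) x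

theorem continuous_powEmp {N : ℕ} (p : ℕ) (f : C(I, ℝ)) :
    Continuous (powEmp p f : State N → ℝ) := by
  unfold powEmp
  fun_prop

/-- The power mean inequality for the empirical measures. -/
theorem powEmp_one_pow_le {N : ℕ} (p n : ℕ) (x : State N) :
    powEmp p 1 x ^ (n + 1) ≤ powEmp (p * (n + 1)) 1 x := by
  rcases Nat.eq_zero_or_pos N with rfl | hN
  · simp [powEmp]
  have hN' : (0 : ℝ) < N := by exact_mod_cast hN
  have := pow_sum_div_card_le_sum_pow (s := Finset.univ) (f := fun k => (x k : ℝ) ^ p)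
    (fun k _ => by positivity) n
  simp only [Finset.card_univ, Fintype.card_fin] at this
  rw [powEmp_one_eq, powEmp_one_eq, mul_pow]
  rw [div_le_iff₀ (by positivity)] at this
  simp_rw [pow_mul]
  calc (1 / N : ℝ) ^ (n + 1) * (∑ k, (x k : ℝ) ^ p) ^ (n + 1)
      ≤ (1 / N : ℝ) ^ (n + 1) * ((∑ k, ((x k : ℝ) ^ p) ^ (n + 1)) * N ^ n) := by gcongr
    _ = (1 / N : ℝ) * ∑ k, ((x k : ℝ) ^ p) ^ (n + 1) := by
      rw [pow_succ, one_div, inv_pow]; field_simp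

theorem powEmp_jumpSite_sub (M : Coeffs) {N : ℕ} (p : ℕ) (f : C(I, ℝ)) (i : Fin N) (x : State N) :
    powEmp p f (jumpSite M i x) - powEmp p f x =
      (1 / N : ℝ) * (f (pos i) * ((M.c (pos i) * x i) ^ p - (x i : ℝ) ^ p)) := by
  rw [powEmp, powEmp, ← mul_sub, sum_jumpSite_sub M (fun k y => (y : ℝ) ^ p * f (pos k))]
  push_cast
  ring

theorem powEmp_jumpPair_sub (M : Coeffs) {N : ℕ} (p : ℕ) (f : C(I, ℝ)) {i j : Fin N} (hij : j ≠ i)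
    (x : State N) :
    powEmp p f (jumpPair M i j x) - powEmp p f x = (1 / N : ℝ) *
      (f (pos i) *
        ((M.a₁ (pos i, pos j) * x i + M.a₂ (pos i, pos j) * x j) ^ p - (x i : ℝ) ^ p) +
      f (pos j) *
        ((M.a₃ (pos i, pos j) * x i + M.a₄ (pos i, pos j) * x j) ^ p - (x j : ℝ) ^ p)) := by
  rw [powEmp, powEmp, ← mul_sub, sum_jumpPair_sub M (fun k y => (y : ℝ) ^ p * f (pos k)) hij]
  push_cast
  ring

/-- The carré du champ of an empirical average is of order `1/N`. -/
theorem gam_powEmp_le {M : Coeffs} {K : ℝ} (hK : M.BoundedBy K) {N : ℕ} (p : ℕ) (f : C(I, ℝ))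
    {R : ℝ} (hR : ‖f‖ ≤ R) (x : State N) :
    gam M (powEmp p f) x ≤ 24 * K * (2 * K) ^ p * (2 * K) ^ p * R ^ 2 / N *
      powEmp (p * 2) 1 x := by
  have hK0 : 0 ≤ K := zero_le_one.trans hK.one_le
  have hf : ∀ u, |f u| ≤ R := fun u => (f.norm_coe_le_norm u).trans hR
  have hκ1 : 1 ≤ (2 * K) ^ p := one_le_pow₀ (by linarith [hK.one_le])
  set κ := (2 * K) ^ p with hκ
  have hR0 : 0 ≤ R := (norm_nonneg f).trans hR
  have hlin : ∀ (a a' : ℝ≥0) (i j : Fin N), (a : ℝ) ≤ K → (a' : ℝ) ≤ K →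
      |(a * x i + a' * x j : ℝ) ^ p - (x i : ℝ) ^ p| ≤ κ * ((x i : ℝ) ^ p + (x j : ℝ) ^ p) ∧
      |(a * x i + a' * x j : ℝ) ^ p - (x j : ℝ) ^ p| ≤ κ * ((x i : ℝ) ^ p + (x j : ℝ) ^ p) := by
    intro a a' i j ha ha'
    have h1 : (a * x i + a' * x j : ℝ) ^ p ≤ κ * ((x i : ℝ) ^ p + (x j : ℝ) ^ p) :=
      pow_linear_le a.2 a'.2 (x i).2 (x j).2 ha ha' p
    have h2 : 0 ≤ (a * x i + a' * x j : ℝ) ^ p := by positivity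
    have hi : 0 ≤ (x i : ℝ) ^ p := by positivity
    have hj : 0 ≤ (x j : ℝ) ^ p := by positivity
    constructor <;> rw [abs_le] <;> constructor <;>
      nlinarith [mul_nonneg (sub_nonneg.2 hκ1) hi, mul_nonneg (sub_nonneg.2 hκ1) hj]
  -- Each of the two changed summands contributes at most Rκ(y + z), and (2Rκ(y + z))² ≤ 8R²κ²(y² +
  -- z²). The rate factor 3K turns the 8 into 24K.
  have := jumpSum_le hK (x := x) (g := fun y => (powEmp p f y - powEmp p f x) ^ 2)
    (A := fun k => (1 / N : ℝ) ^ 2 * (8 * κ ^ 2 * R ^ 2) * ((x k : ℝ) ^ p) ^ 2)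
    (fun k => by positivity) (fun i => ?_) (fun i j hij => ?_)
  · refine this.trans (le_of_eq ?_)
    rw [← Finset.mul_sum, powEmp_one_eq]
    simp_rw [pow_mul]
    rcases Nat.eq_zero_or_pos N with rfl | hN
    · simp
    have hN' : (N : ℝ) ≠ 0 := by exact_mod_cast hN.ne'
    field_simp
    ring
  · rw [powEmp_jumpSite_sub, mul_pow, mul_assoc ((1 / N : ℝ) ^ 2)]
    refine mul_le_mul_of_nonneg_left ?_ (by positivity)
    have h := (hlin (M.c (pos i)) 0 i i (hK.c_le _) (by simpa using hK0)).1
    simp only [NNReal.coe_zero, zero_mul, add_zero] at h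
    rw [← sq_abs, abs_mul]
    calc _ ≤ (R * (κ * ((x i : ℝ) ^ p + (x i : ℝ) ^ p))) ^ 2 := by
          gcongr
          exact hf _
      _ ≤ _ := by
          have : 0 ≤ (R * κ * (x i : ℝ) ^ p) ^ 2 := sq_nonneg _
          nlinarith
  · rw [powEmp_jumpPair_sub M p f hij, mul_pow, mul_assoc ((1 / N : ℝ) ^ 2),
      mul_assoc ((1 / N : ℝ) ^ 2), ← mul_add]
    refine mul_le_mul_of_nonneg_left ?_ (by positivity)
    have h1 := (hlin (M.a₁ (pos i, pos j)) (M.a₂ (pos i, pos j)) i j (hK.a₁_le _) (hK.a₂_le _)).1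
    have h2 := (hlin (M.a₃ (pos i, pos j)) (M.a₄ (pos i, pos j)) i j (hK.a₃_le _) (hK.a₄_le _)).2
    set y := (x i : ℝ) ^ p
    set z := (x j : ℝ) ^ p
    have hy : 0 ≤ y := by positivity
    have hz : 0 ≤ z := by positivity
    rw [← sq_abs]
    calc _ ≤ (R * (κ * (y + z)) + R * (κ * (y + z))) ^ 2 := by
          gcongr
          refine (abs_add_le _ _).trans (add_le_add ?_ ?_) <;> rw [abs_mul]
          · exact mul_le_mul (hf _) h1 (abs_nonneg _) hR0
          · exact mul_le_mul (hf _) h2 (abs_nonneg _) hR0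
      _ ≤ _ := by
          have : 0 ≤ (R * κ * (y - z)) ^ 2 := sq_nonneg _
          nlinarith

/-! ### The drift of the empirical measures -/

/-- The interaction part of the drift of the `p`-th powers, which comes from mixed products. -/
def crossTerm (M : Coeffs) {N : ℕ} (p : ℕ) (f : C(I, ℝ)) (x : State N) : ℝ :=
  (1 / N : ℝ) * ((1 / N : ℝ) * ∑ i : Fin N, ∑ j ∈ Finset.univ.filter (fun j => j ≠ i),
    (M.lam (pos i, pos j) : ℝ) *
      (f (pos i) * ((M.a₁ (pos i, pos j) * x i + M.a₂ (pos i, pos j) * x j) ^ p -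
        (M.a₁ (pos i, pos j) : ℝ) ^ p * (x i : ℝ) ^ p -
        (M.a₂ (pos i, pos j) : ℝ) ^ p * (x j : ℝ) ^ p) +
      f (pos j) * ((M.a₃ (pos i, pos j) * x i + M.a₄ (pos i, pos j) * x j) ^ p -
        (M.a₃ (pos i, pos j) : ℝ) ^ p * (x i : ℝ) ^ p -
        (M.a₄ (pos i, pos j) : ℝ) ^ p * (x j : ℝ) ^ p)))

theorem sum_sum_ne {N : ℕ} (F : Fin N → Fin N → ℝ) :
    ∑ i, ∑ j ∈ Finset.univ.filter (fun j => j ≠ i), F i j = ∑ i, ∑ j, F i j - ∑ i, F i i := by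
  rw [← Finset.sum_sub_distrib]
  refine Finset.sum_congr rfl fun i _ => ?_
  rw [Finset.filter_ne', eq_sub_iff_add_eq, Finset.sum_erase_add _ _ (Finset.mem_univ i)]

theorem driftPot_apply (M : Coeffs) (p : ℕ) (u v : I) :
    driftPot M p (u, v) = M.lam (u, v) * ((M.a₁ (u, v) : ℝ) ^ p - 1) +
      M.lam (v, u) * ((M.a₄ (v, u) : ℝ) ^ p - 1) := by
  simp [driftPot, swapK, toR]

theorem driftKer_apply (M : Coeffs) (p : ℕ) (u v : I) :
    driftKer M p (u, v) = M.lam (v, u) * (M.a₂ (v, u) : ℝ) ^ p +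
      M.lam (u, v) * (M.a₃ (u, v) : ℝ) ^ p := by
  simp [driftKer, swapK, toR]

theorem driftMul_apply (M : Coeffs) (p : ℕ) (u : I) :
    driftMul M p u = ((M.c u : ℝ) ^ p - 1) * M.b u := by
  simp [driftMul, toR]

/-- Each p-th power of a linear combination splits into two pure powers and a mixed remainder; the
remainders form `crossTerm`. After relabelling, every pure term carries x(i)^p, so the sum over j is
a Riemann sum. The excluded diagonal j = i leaves the 1/N correction. -/
theorem gen_powEmp (M : Coeffs) {N : ℕ} (p : ℕ) (f : C(I, ℝ)) (x : State N) :
    gen M (powEmp p f) x = crossTerm M p f x +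
      (1 / N : ℝ) * ∑ i, (x i : ℝ) ^ p * (driftMul M p (pos i) * f (pos i) +
        f (pos i) * riemann N ((driftPot M p).curry (pos i)) +
        riemann N ((driftKer M p).curry (pos i) * f) -
        (1 / N : ℝ) * (f (pos i) *
          (driftPot M p (pos i, pos i) + driftKer M p (pos i, pos i)))) := by
  have e1 : gen M (powEmp p f) x =
      (1 / N : ℝ) * ∑ i, (x i : ℝ) ^ p * (driftMul M p (pos i) * f (pos i)) +
      (crossTerm M p f x + (1 / N : ℝ) * ((1 / N : ℝ) *
        ∑ i : Fin N, ∑ j ∈ Finset.univ.filter (fun j => j ≠ i), (M.lam (pos i, pos j) : ℝ) *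
        (f (pos i) * (((M.a₁ (pos i, pos j) : ℝ) ^ p - 1) * (x i : ℝ) ^ p +
          (M.a₂ (pos i, pos j) : ℝ) ^ p * (x j : ℝ) ^ p) +
        f (pos j) * ((M.a₃ (pos i, pos j) : ℝ) ^ p * (x i : ℝ) ^ p +
          ((M.a₄ (pos i, pos j) : ℝ) ^ p - 1) * (x j : ℝ) ^ p)))) := by
    unfold gen jumpSum crossTerm
    conv_rhs =>
      arg 2
      rw [← mul_add, ← mul_add, ← Finset.sum_add_distrib]
      enter [2, 2, 2, i]
      rw [← Finset.sum_add_distrib]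
    congr 1
    · rw [Finset.mul_sum]
      refine Finset.sum_congr rfl fun i _ => ?_
      beta_reduce
      rw [powEmp_jumpSite_sub, driftMul_apply, mul_pow]
      ring
    · congr 1
      rw [Finset.mul_sum]
      refine Finset.sum_congr rfl fun i _ => ?_
      rw [Finset.mul_sum]
      refine Finset.sum_congr rfl fun j hj => ?_
      beta_reduce
      rw [powEmp_jumpPair_sub M p f (Finset.mem_filter.1 hj).2]
      ring
  have e2 : ∑ i : Fin N, ∑ j : Fin N, (M.lam (pos i, pos j) : ℝ) *
        (f (pos i) * (((M.a₁ (pos i, pos j) : ℝ) ^ p - 1) * (x i : ℝ) ^ p +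
          (M.a₂ (pos i, pos j) : ℝ) ^ p * (x j : ℝ) ^ p) +
        f (pos j) * ((M.a₃ (pos i, pos j) : ℝ) ^ p * (x i : ℝ) ^ p +
          ((M.a₄ (pos i, pos j) : ℝ) ^ p - 1) * (x j : ℝ) ^ p)) =
      ∑ i : Fin N, ∑ j : Fin N, (x i : ℝ) ^ p * (f (pos i) * driftPot M p (pos i, pos j) +
        driftKer M p (pos i, pos j) * f (pos j)) := by
    simp_rw [driftPot_apply, driftKer_apply]
    -- Exchanging the names i and j moves the x(j)^p terms onto x(i)^p; this is why `driftPot` and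
    -- `driftKer` mix kernels with swapped ones.
    have hswap := Finset.sum_comm (s := (Finset.univ : Finset (Fin N)))
      (t := (Finset.univ : Finset (Fin N)))
      (f := fun i j => (M.lam (pos i, pos j) : ℝ) * (x j : ℝ) ^ p *
        (f (pos i) * (M.a₂ (pos i, pos j) : ℝ) ^ p +
          f (pos j) * ((M.a₄ (pos i, pos j) : ℝ) ^ p - 1)))
    have hl : ∀ i j : Fin N, (M.lam (pos i, pos j) : ℝ) *
        (f (pos i) * (((M.a₁ (pos i, pos j) : ℝ) ^ p - 1) * (x i : ℝ) ^ p +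
          (M.a₂ (pos i, pos j) : ℝ) ^ p * (x j : ℝ) ^ p) +
        f (pos j) * ((M.a₃ (pos i, pos j) : ℝ) ^ p * (x i : ℝ) ^ p +
          ((M.a₄ (pos i, pos j) : ℝ) ^ p - 1) * (x j : ℝ) ^ p)) =
        (M.lam (pos i, pos j) : ℝ) * (x j : ℝ) ^ p *
        (f (pos i) * (M.a₂ (pos i, pos j) : ℝ) ^ p +
          f (pos j) * ((M.a₄ (pos i, pos j) : ℝ) ^ p - 1)) +
        (M.lam (pos i, pos j) : ℝ) * (x i : ℝ) ^ p *
        (f (pos i) * ((M.a₁ (pos i, pos j) : ℝ) ^ p - 1) +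
          f (pos j) * (M.a₃ (pos i, pos j) : ℝ) ^ p) := fun i j => by ring
    simp_rw [hl, Finset.sum_add_distrib]
    rw [hswap, ← Finset.sum_add_distrib]
    simp_rw [← Finset.sum_add_distrib]
    exact Finset.sum_congr rfl fun i _ => Finset.sum_congr rfl fun j _ => by ring
  rw [e1, sum_sum_ne, e2, add_left_comm, add_right_inj, ← mul_add, mul_sub, Finset.mul_sum,
    Finset.mul_sum, ← Finset.sum_sub_distrib, ← Finset.sum_add_distrib]
  congr 1
  refine Finset.sum_congr rfl fun i _ => ?_
  rw [← Finset.mul_sum, Finset.sum_add_distrib, ← Finset.mul_sum]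
  simp only [riemann, ContinuousMap.curry_apply, ContinuousMap.mul_apply]
  rw [driftPot_apply M p (pos i) (pos i), driftKer_apply M p (pos i) (pos i)]
  ring

theorem exists_pos_norm_bound {S : Set C(I, ℝ)} (hS : IsCompact S) :
    ∃ R : ℝ, 0 < R ∧ ∀ f ∈ S, ‖f‖ ≤ R := by
  obtain ⟨R, hR⟩ := hS.isBounded.exists_norm_le
  exact ⟨max R 1, by positivity, fun f hf => (hR f hf).trans (le_max_left _ _)⟩

theorem eventually_div_le (D : ℝ) {ε : ℝ} (hε : 0 < ε) : ∀ᶠ N : ℕ in atTop, D / N ≤ ε :=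
  ((tendsto_const_div_atTop_nhds_zero_nat D).eventually_lt_const hε).mono fun _ h => h.le

theorem isCompact_curry_mul (k : C(I × I, ℝ)) {S : Set C(I, ℝ)} (hS : IsCompact S) :
    IsCompact ((fun z : I × C(I, ℝ) => k.curry z.1 * z.2) '' (Set.univ ×ˢ S)) :=
  (isCompact_univ.prod hS).image (by fun_prop)

theorem genOp_apply (m : C(I, ℝ)) (q κ : C(I × I, ℝ)) (f : C(I, ℝ)) (u : I) :
    genOp m q κ f u = m u * f u + f u * (∫ v, q.curry u v) + ∫ v, (κ.curry u * f) v := by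
  simp [genOp, mulOp_apply, kernelOp_apply, mul_comm, mul_add]

/-- The drift of the empirical measures is close to its limit. -/
theorem gen_powEmp_approx (M : Coeffs) (p : ℕ) {S : Set C(I, ℝ)} (hS : IsCompact S) {ε : ℝ}
    (hε : 0 < ε) : ∀ᶠ N in atTop, ∀ f ∈ S, ∀ x : State N,
      |gen M (powEmp p f) x - powEmp p (driftOp M p f) x - crossTerm M p f x| ≤
        ε * powEmp p 1 x := by
  obtain ⟨R, hR, hSR⟩ := exists_pos_norm_bound hS
  have hQ : IsCompact (Set.range (driftPot M p).curry) :=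
    isCompact_range (driftPot M p).curry.continuous
  filter_upwards [riemann_uniform hQ (by positivity : 0 < ε / (3 * R)),
    riemann_uniform (isCompact_curry_mul (driftKer M p) hS) (by positivity : 0 < ε / 3),
    eventually_div_le (R * (‖driftPot M p‖ + ‖driftKer M p‖)) (by positivity : 0 < ε / 3)]
    with N h1 h2 h3 f hf x
  have hfR : ∀ u, |f u| ≤ R := fun u => (f.norm_coe_le_norm u).trans (hSR f hf)
  have e : gen M (powEmp p f) x - powEmp p (driftOp M p f) x - crossTerm M p f x =
      (1 / N : ℝ) * ∑ i, (x i : ℝ) ^ p *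
        (f (pos i) * (riemann N ((driftPot M p).curry (pos i)) -
          ∫ v, (driftPot M p).curry (pos i) v) +
        (riemann N ((driftKer M p).curry (pos i) * f) -
          ∫ v, ((driftKer M p).curry (pos i) * f) v) -
        (1 / N : ℝ) * (f (pos i) *
          (driftPot M p (pos i, pos i) + driftKer M p (pos i, pos i)))) := by
    rw [gen_powEmp, powEmp, sub_right_comm, add_sub_cancel_left, ← mul_sub,
      ← Finset.sum_sub_distrib]
    congr 1
    refine Finset.sum_congr rfl fun i _ => ?_
    rw [driftOp, genOp_apply]
    ring
  rw [e]
  refine abs_weighted_powEmp_le p (fun i => ?_) x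
  have b1 : |f (pos i) * (riemann N ((driftPot M p).curry (pos i)) -
      ∫ v, (driftPot M p).curry (pos i) v)| ≤ ε / 3 := by
    rw [abs_mul]
    calc _ ≤ R * (ε / (3 * R)) :=
          mul_le_mul (hfR _) (h1 _ ⟨pos i, rfl⟩) (abs_nonneg _) hR.le
      _ = ε / 3 := by field_simp
  have b2 := h2 _ ⟨(pos i, f), ⟨Set.mem_univ _, hf⟩, rfl⟩
  have b3 : |(1 / N : ℝ) * (f (pos i) *
      (driftPot M p (pos i, pos i) + driftKer M p (pos i, pos i)))| ≤ ε / 3 := by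
    refine le_trans ?_ h3
    rw [abs_mul, abs_mul, abs_of_nonneg (by positivity : (0 : ℝ) ≤ 1 / N),
      div_eq_inv_mul (_ * _), one_div]
    gcongr
    · exact hfR _
    · exact (abs_add_le _ _).trans (add_le_add ((driftPot M p).norm_coe_le_norm _)
        ((driftKer M p).norm_coe_le_norm _))
  refine (abs_sub _ _).trans ((add_le_add (abs_add_le _ _) le_rfl).trans ?_)
  linarith

/-! ### Growth and second-moment estimates for the empirical averages -/

theorem PolyGrowth.of_abs_le {N : ℕ} {f g : State N → ℝ} (hg : PolyGrowth g) (hf : Continuous f)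
    (h : ∀ x, |f x| ≤ g x) : PolyGrowth f := by
  obtain ⟨_, C, hC, hgC⟩ := hg
  exact ⟨hf, C, hC, fun x => (h x).trans ((le_abs_self _).trans (hgC x))⟩

theorem polyGrowth_monomial {N : ℕ} (i j : Fin N) {a b : ℕ} (hab : a + b ≤ 6) :
    PolyGrowth (fun x : State N => (x i : ℝ) ^ a * (x j : ℝ) ^ b) := by
  refine ⟨by fun_prop, 2, by norm_num, fun x => ?_⟩
  have hle : ∀ i, (x i : ℝ) ^ 6 ≤ ∑ k, (x k : ℝ) ^ 6 := fun i =>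
    Finset.single_le_sum (f := fun k => (x k : ℝ) ^ 6) (fun k _ => by positivity)
      (Finset.mem_univ i)
  rw [abs_of_nonneg (by positivity)]
  set z : ℝ := max 1 (max (x i) (x j)) with hz
  have hz1 : 1 ≤ z := le_max_left _ _
  have hxi : (x i : ℝ) ≤ z := (le_max_left _ _).trans (le_max_right _ _)
  have hxj : (x j : ℝ) ≤ z := (le_max_right _ _).trans (le_max_right _ _)
  have hi := hle i
  have hj := hle j
  have hi0 : 0 ≤ (x i : ℝ) ^ 6 := by positivity
  calc (x i : ℝ) ^ a * (x j : ℝ) ^ b ≤ z ^ a * z ^ b := by gcongr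
    _ = z ^ (a + b) := (pow_add _ _ _).symm
    _ ≤ z ^ 6 := pow_le_pow_right₀ hz1 hab
    _ ≤ 2 * (1 + ∑ k, (x k : ℝ) ^ 6) := by
      rcases max_choice (1 : ℝ) (max (x i) (x j)) with h | h
      · rw [hz, h]; linarith
      · rw [hz, h]
        rcases max_choice (x i : ℝ) (x j) with h' | h' <;> rw [h'] <;> linarith

theorem polyGrowth_powEmp {N : ℕ} {p : ℕ} (hp : p ≤ 6) (f : C(I, ℝ)) :
    PolyGrowth (powEmp p f : State N → ℝ) := by
  have : (powEmp p f : State N → ℝ) =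
      fun x => ∑ k, (1 / N : ℝ) * f (pos k) * (x k : ℝ) ^ p := by
    ext x; exact powEmp_eq_sum p f x
  rw [this]
  refine PolyGrowth.sum _ fun k _ => PolyGrowth.const_mul ?_ _
  simpa using polyGrowth_monomial k k (a := p) (b := 0) (by omega)

theorem polyGrowth_powEmp_sub_sq {N : ℕ} {p : ℕ} (hp : p ≤ 3) (f : C(I, ℝ)) (c : ℝ) :
    PolyGrowth (fun x : State N => (powEmp p f x - c) ^ 2) := by
  have h1 : PolyGrowth (fun x : State N => 2 * (‖f‖ ^ 2 * powEmp (p * 2) 1 x + c ^ 2)) :=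
    (((polyGrowth_powEmp (by omega) 1).const_mul _).add (PolyGrowth.const _)).const_mul _
  refine h1.of_abs_le (((continuous_powEmp p f).sub continuous_const).pow 2) fun x => ?_
  rw [abs_of_nonneg (sq_nonneg _)]
  have h2 : powEmp p f x ^ 2 ≤ ‖f‖ ^ 2 * powEmp (p * 2) 1 x := by
    calc powEmp p f x ^ 2 = |powEmp p f x| ^ 2 := (sq_abs _).symm
      _ ≤ (‖f‖ * powEmp p 1 x) ^ 2 := by gcongr; exact abs_powEmp_le p f x
      _ = ‖f‖ ^ 2 * powEmp p 1 x ^ 2 := mul_pow _ _ _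
      _ ≤ _ := by gcongr; exact powEmp_one_pow_le p 1 x
  nlinarith [sq_nonneg (powEmp p f x + c)]

section Observables

variable {M : Coeffs} {N : ℕ} {Ω : Type*} [MeasurableSpace Ω] {P : Measure Ω}
  [IsProbabilityMeasure P] {X : ℝ≥0 → Ω → State N}

theorem expect_powEmp_one_le {K : ℝ} (hK : M.BoundedBy K) (hX : IsLinearSystem M N P X)
    (h0 : ∀ᵐ ω ∂P, ∀ i, X 0 ω i = 0 ∨ X 0 ω i = 1) (p : ℕ) {t : ℝ} (ht : 0 ≤ t) :
    expect P X t (powEmp p 1) ≤ Real.exp (6 * K * (2 * K) ^ p * t) := by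
  have h := (moment_bound hK hX h0 p ht).2
  have e : expect P X t (powEmp p 1) =
      (1 / N : ℝ) * expect P X t (fun x => ∑ k, (x k : ℝ) ^ p) := by
    unfold expect
    rw [← integral_const_mul]
    simp only [powEmp_one_eq]
  rw [e]
  rcases Nat.eq_zero_or_pos N with rfl | hN
  · simp; positivity
  have hN' : (0 : ℝ) < N := by exact_mod_cast hN
  calc _ ≤ (1 / N : ℝ) * (N * Real.exp (6 * K * (2 * K) ^ p * t)) := by gcongr
    _ = _ := by field_simp

/-- The general second-moment bound for a test function run backward: its derivative contributes
-ν_p(A_p f), so only the discrepancy between the generator and A_p, less the drift c' of the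
centring, remains. -/
theorem powEmp_second_moment_le (hX : IsLinearSystem M N P X)
    (h0 : ∀ᵐ ω ∂P, ∀ i, X 0 ω i = 0 ∨ X 0 ω i = 1) {p : ℕ} (hp : p ≤ 3)
    {f : ℝ → C(I, ℝ)} (hf : ∀ s, HasDerivAt f (-(driftOp M p (f s))) s)
    {c c' : ℝ → ℝ} (hc : ∀ s, HasDerivAt c (c' s) s) {t η : ℝ}
    (ht : 0 ≤ t) (hη : 0 ≤ η) {B : ℝ → State N → ℝ} (hBg : ∀ s, PolyGrowth (B s))
    (hB : ∀ s ∈ Set.Ioo 0 t, ∀ x,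
      (gen M (powEmp p (f s)) x - powEmp p (driftOp M p (f s)) x - c' s) ^ 2
        + gam M (powEmp p (f s)) x ≤ B s x)
    (hBη : ∀ s ∈ Set.Ioo 0 t, expect P X s (B s) ≤ η) :
    expect P X t (fun x => (powEmp p (f t) x - c t) ^ 2) ≤
      Real.exp t * (expect P X 0 (fun x => (powEmp p (f 0) x - c 0) ^ 2) + η * t) := by
  -- The extra index `none` carries the constant function 1 with coefficient -c(s), so the centring
  -- becomes part of the linear combination.
  set φ : Option (Fin N) → State N → ℝ := fun a x => a.elim 1 fun k => (x k : ℝ) ^ p with hφ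
  set α : ℝ → Option (Fin N) → ℝ := fun s a => a.elim (-(c s)) fun k => (1 / N : ℝ) * f s (pos k)
    with hα
  set α' : ℝ → Option (Fin N) → ℝ := fun s a =>
    a.elim (-(c' s)) fun k => (1 / N : ℝ) * (-(driftOp M p (f s))) (pos k) with hα'
  have hsum : ∀ s x, ∑ a, α s a * φ a x = powEmp p (f s) x - c s := fun s x => by
    rw [Fintype.sum_option, powEmp_eq_sum]
    simp only [hα, hφ, Option.elim]
    ring
  have hsum' : ∀ s x, ∑ a, α' s a * φ a x = -(powEmp p (driftOp M p (f s)) x) - c' s :=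
    fun s x => by
      rw [Fintype.sum_option, powEmp_eq_sum]
      simp only [hα', hφ, Option.elim, ContinuousMap.neg_apply, mul_neg, neg_mul,
        Finset.sum_neg_distrib]
      ring
  have hgen : ∀ s (x : State N), gen M (fun y => powEmp p (f s) y - c s) x = gen M (powEmp p (f s)) x := by
    intro s x
    simp [gen]
  have hgam : ∀ s (x : State N), gam M (fun y => powEmp p (f s) y - c s) x = gam M (powEmp p (f s)) x := by
    intro s x
    simp [gam]
  have key := second_moment_le hX h0 (φ := φ) ?_ (α := α) (α' := α') ?_ ht hη hBg ?_ hBη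
  · simpa only [hsum] using key
  · rintro (_ | i) (_ | j)
    · simpa [hφ] using PolyGrowth.const (N := N) 1
    · simpa [hφ] using polyGrowth_monomial j j (a := p) (b := 0) (by omega)
    · simpa [hφ] using polyGrowth_monomial i i (a := p) (b := 0) (by omega)
    · exact polyGrowth_monomial i j (by omega)
  · rintro (_ | k) s
    · exact (hc s).neg
    · have h1 := (ContinuousMap.evalCLM ℝ (pos k)).hasFDerivAt.comp_hasDerivAt s (hf s)
      exact h1.const_mul (1 / N : ℝ)
  · intro s hs x
    simp only [hsum, hsum', hgen, hgam]
    refine le_trans (le_of_eq ?_) (hB s hs x)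
    ring

end Observables

/-! ### The initial state -/

section Initial

variable {φ : C(I, ℝ)} {N : ℕ} {Ω : Type*} [MeasurableSpace Ω] {P : Measure Ω}
  [IsProbabilityMeasure P] {X₀ : Ω → State N}

theorem IsInitialState.ae_zero_or_one (h : IsInitialState φ N P X₀) (hm : Measurable X₀) :
    ∀ᵐ ω ∂P, ∀ i, X₀ ω i = 0 ∨ X₀ ω i = 1 := by
  rw [ae_all_iff]
  intro i
  have hmi : Measurable fun ω => X₀ ω i := (measurable_pi_apply i).comp hm
  have h0 : MeasurableSet {ω | X₀ ω i = 0} := hmi (measurableSet_singleton 0)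
  have h1 : MeasurableSet {ω | X₀ ω i = 1} := hmi (measurableSet_singleton 1)
  have hd : Disjoint {ω | X₀ ω i = 0} {ω | X₀ ω i = 1} := by
    rw [Set.disjoint_left]
    intro ω hω hω'
    simp only [Set.mem_ofPred_eq] at hω hω'
    simp [hω] at hω'
  have hu : P.real ({ω | X₀ ω i = 0} ∪ {ω | X₀ ω i = 1}) = 1 := by
    rw [measureReal_union hd h1, h.prob_one, h.prob_zero]
    ring
  have hu' : P ({ω | X₀ ω i = 0} ∪ {ω | X₀ ω i = 1})ᶜ = 0 := by
    rw [← measureReal_eq_zero_iff, probReal_compl_eq_one_sub (h0.union h1), hu, sub_self]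
  filter_upwards [compl_mem_ae_iff.2 hu'] with ω hω
  rw [compl_compl] at hω
  exact hω

theorem IsInitialState.integral_pow (h : IsInitialState φ N P X₀) (hm : Measurable X₀) {p : ℕ}
    (hp : p ≠ 0) (i : Fin N) : ∫ ω, (X₀ ω i : ℝ) ^ p ∂P = φ (pos i) := by
  have hmi : Measurable fun ω => X₀ ω i := (measurable_pi_apply i).comp hm
  have h1 : MeasurableSet {ω | X₀ ω i = 1} := hmi (measurableSet_singleton 1)
  rw [← h.prob_one i, ← integral_indicator_one h1]
  refine integral_congr_ae ?_
  filter_upwards [h.ae_zero_or_one hm] with ω hω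
  rcases hω i with h | h <;> simp [Set.indicator, h, hp]

/-- Variance plus squared bias. The N independent summands are bounded by ‖f‖/N, so the variance is
at most N(‖f‖/N)². The mean is a Riemann sum of φf, since powers with p ≠ 0 do not change a {0,
1}-valued variable. -/
theorem IsInitialState.expect_powEmp_sub_sq_le (h : IsInitialState φ N P X₀) (hm : Measurable X₀)
    {p : ℕ} (hp : p ≠ 0) (f : C(I, ℝ)) (c : ℝ) :
    ∫ ω, (powEmp p f (X₀ ω) - c) ^ 2 ∂P ≤ ‖f‖ ^ 2 / N + (riemann N (φ * f) - c) ^ 2 := by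
  have hmi : ∀ i, Measurable fun ω => X₀ ω i := fun i => (measurable_pi_apply i).comp hm
  set Z : Fin N → Ω → ℝ := fun i ω => (1 / N : ℝ) * f (pos i) * (X₀ ω i : ℝ) ^ p with hZ
  have hZm : ∀ i, Measurable (Z i) := fun i =>
    ((measurable_coe_nnreal_real.comp (hmi i)).pow_const p).const_mul _
  have hZb : ∀ i, ∀ᵐ ω ∂P, ‖Z i ω‖ ≤ (1 / N : ℝ) * ‖f‖ := fun i => by
    filter_upwards [h.ae_zero_or_one hm] with ω hω
    rw [hZ, norm_mul, norm_mul, Real.norm_of_nonneg (by positivity : (0 : ℝ) ≤ 1 / N)]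
    refine (mul_le_of_le_one_right (by positivity) ?_).trans
      (mul_le_mul_of_nonneg_left (f.norm_coe_le_norm _) (by positivity))
    rcases hω i with h | h <;> simp [h, hp]
  have hZ2 : ∀ i, MemLp (Z i) 2 P := fun i =>
    MemLp.of_bound (hZm i).aestronglyMeasurable _ (hZb i)
  have hsum : ∀ ω, powEmp p f (X₀ ω) = (∑ i, Z i) ω := fun ω => by
    rw [powEmp_eq_sum, Finset.sum_apply]
  have hind : Set.Pairwise (↑(Finset.univ : Finset (Fin N)))
      fun i j => IndepFun (Z i) (Z j) P := by
    intro i _ j _ hij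
    have hg : ∀ i : Fin N, Measurable fun y : ℝ≥0 => (1 / N : ℝ) * f (pos i) * (y : ℝ) ^ p :=
      fun i => (measurable_coe_nnreal_real.pow_const p).const_mul _
    exact (h.indep.indepFun hij).comp (hg i) (hg j)
  have hvar : Var[∑ i, Z i; P] ≤ ‖f‖ ^ 2 / N := by
    rw [IndepFun.variance_sum (fun i _ => hZ2 i) hind]
    have : ∀ i, Var[Z i; P] ≤ ((1 / N : ℝ) * ‖f‖) ^ 2 := fun i => by
      refine (variance_le_expectation_sq (hZm i).aestronglyMeasurable).trans ?_
      have h1 : ∫ ω, Z i ω ^ 2 ∂P ≤ ∫ _, ((1 / N : ℝ) * ‖f‖) ^ 2 ∂P := by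
        refine integral_mono_ae (hZ2 i).integrable_sq (integrable_const _) ?_
        filter_upwards [hZb i] with ω hω
        rw [← sq_abs]
        exact pow_le_pow_left₀ (abs_nonneg _) hω 2
      simpa using h1
    refine (Finset.sum_le_sum fun i _ => this i).trans (le_of_eq ?_)
    rcases Nat.eq_zero_or_pos N with rfl | hN
    · simp
    have hN' : (N : ℝ) ≠ 0 := by exact_mod_cast hN.ne'
    simp only [Finset.sum_const, Finset.card_univ, Fintype.card_fin, nsmul_eq_mul]
    field_simp
  have hmean : ∫ ω, (∑ i, Z i) ω ∂P = riemann N (φ * f) := by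
    simp only [Finset.sum_apply]
    rw [integral_finsetSum _ fun i _ => (hZ2 i).integrable one_le_two, riemann, Finset.mul_sum]
    refine Finset.sum_congr rfl fun i _ => ?_
    rw [hZ, integral_const_mul, h.integral_pow hm hp, ContinuousMap.mul_apply]
    ring
  have hS2 : MemLp (∑ i, Z i) 2 P := memLp_finsetSum' _ fun i _ => hZ2 i
  have hS1 := hS2.integrable one_le_two
  have hexp : ∫ ω, (powEmp p f (X₀ ω) - c) ^ 2 ∂P =
      Var[∑ i, Z i; P] + (riemann N (φ * f) - c) ^ 2 := by
    have e1 : ∀ ω, (powEmp p f (X₀ ω) - c) ^ 2 =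
        (∑ i, Z i) ω ^ 2 - (2 * c * (∑ i, Z i) ω - c ^ 2) := fun ω => by
      rw [hsum]; ring
    have e2 := variance_eq_sub hS2
    simp only [Pi.pow_apply] at e2
    have i1 : Integrable (fun ω => 2 * c * (∑ i, Z i) ω) P := hS1.const_mul _
    have i2 : Integrable (fun ω => 2 * c * (∑ i, Z i) ω - c ^ 2) P := i1.sub (integrable_const _)
    simp_rw [e1]
    rw [integral_sub hS2.integrable_sq i2, integral_sub i1 (integrable_const _),
      integral_const_mul, e2, hmean]
    simp only [integral_const, probReal_univ, smul_eq_mul]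
    ring
  rw [hexp]
  linarith

end Initial

theorem initial_lln {φ : C(I, ℝ)} {Ω : ℕ → Type*} [∀ N, MeasurableSpace (Ω N)]
    (P : ∀ N, Measure (Ω N)) [∀ N, IsProbabilityMeasure (P N)] (X₀ : ∀ N, Ω N → State N)
    (hm : ∀ N, 1 ≤ N → Measurable (X₀ N)) (h : ∀ N, 1 ≤ N → IsInitialState φ N (P N) (X₀ N))
    {p : ℕ} (hp : p ≠ 0) {S : Set C(I, ℝ)} (hS : IsCompact S) {ε : ℝ} (hε : 0 < ε) :
    ∀ᶠ N in atTop, ∀ f ∈ S,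
      ∫ ω, (powEmp p f (X₀ N ω) - densityFunctional φ f) ^ 2 ∂(P N) ≤ ε := by
  obtain ⟨R, hR, hSR⟩ := exists_pos_norm_bound hS
  have hS' : IsCompact ((fun f => φ * f) '' S) := hS.image (by fun_prop)
  filter_upwards [riemann_uniform hS' (lt_min zero_lt_one (half_pos hε)),
    eventually_div_le (R ^ 2) (half_pos hε), eventually_ge_atTop 1] with N h1 h2 hN f hf
  refine ((h N hN).expect_powEmp_sub_sq_le (hm N hN) hp f _).trans ?_
  have h3 : |riemann N (φ * f) - densityFunctional φ f| ≤ min 1 (ε / 2) := h1 _ ⟨f, hf, rfl⟩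
  -- The discrepancy is at most both 1 and ε/2, so its square is at most ε/2.
  have h4 : (riemann N (φ * f) - densityFunctional φ f) ^ 2 ≤ ε / 2 := by
    rw [← sq_abs, sq]
    calc _ ≤ 1 * (ε / 2) := mul_le_mul (h3.trans (min_le_left _ _)) (h3.trans (min_le_right _ _))
          (abs_nonneg _) zero_le_one
      _ = ε / 2 := one_mul _
  have h5 : ‖f‖ ^ 2 / N ≤ R ^ 2 / N := by
    have := hSR f hf
    gcongr
  linarith

/-! ### Laws of large numbers for the empirical measures -/

theorem hasDerivAt_densityFunctional {r f : ℝ → C(I, ℝ)} {r' f' : C(I, ℝ)} {s : ℝ}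
    (hr : HasDerivAt r r' s) (hf : HasDerivAt f f' s) :
    HasDerivAt (fun s => densityFunctional (r s) (f s))
      (densityFunctional r' (f s) + densityFunctional (r s) f') s := by
  have h := integralFunctional.hasFDerivAt.comp_hasDerivAt s (hr.mul hf)
  rw [map_add] at h
  exact h

theorem abs_densityFunctional_le (r f : C(I, ℝ)) : |densityFunctional r f| ≤ ‖r‖ * ‖f‖ :=
  (abs_integral_C_le (r * f)).trans (norm_mul_le _ _)

section Observables

variable {M : Coeffs} {N : ℕ} {Ω : Type*} [MeasurableSpace Ω] {P : Measure Ω}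
  [IsProbabilityMeasure P] {X : ℝ≥0 → Ω → State N}

theorem expect_add (hX : IsLinearSystem M N P X) (h0 : ∀ᵐ ω ∂P, ∀ i, X 0 ω i = 0 ∨ X 0 ω i = 1)
    {f g : State N → ℝ} (hf : PolyGrowth f) (hg : PolyGrowth g) (t : ℝ) :
    expect P X t (fun x => f x + g x) = expect P X t f + expect P X t g :=
  integral_add (hf.integrable hX h0 t) (hg.integrable hX h0 t)

end Observables

theorem expect_const_mul {N : ℕ} {Ω : Type*} [MeasurableSpace Ω] (P : Measure Ω)
    (X : ℝ≥0 → Ω → State N) (r : ℝ) (f : State N → ℝ) (t : ℝ) :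
    expect P X t (fun x => r * f x) = r * expect P X t f := integral_const_mul _ _

theorem expect_const {N : ℕ} {Ω : Type*} [MeasurableSpace Ω] (P : Measure Ω)
    [IsProbabilityMeasure P] (X : ℝ≥0 → Ω → State N) (r : ℝ) (t : ℝ) :
    expect P X t (fun _ => r) = r := by
  simp [expect]

section Limit

variable {M : Coeffs} {φ : C(I, ℝ)} {Ω : ℕ → Type*} [∀ N, MeasurableSpace (Ω N)]
  {P : ∀ N, Measure (Ω N)} [∀ N, IsProbabilityMeasure (P N)] {X : ∀ N, ℝ≥0 → Ω N → State N}

/-- The law of large numbers for the empirical measures of the `p`-th powers, provided that the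
interaction term has a limit. -/
theorem powEmp_lln (hX : ∀ N, 1 ≤ N → IsLinearSystem M N (P N) (X N))
    (hX₀ : ∀ N, 1 ≤ N → IsInitialState φ N (P N) (X N 0)) {p : ℕ} (hp : p ≠ 0) (hp3 : p ≤ 3)
    {r h : ℝ → C(I, ℝ)} (hr0 : r 0 = φ)
    (hr : ∀ s, HasDerivAt r (driftOpDual M p (r s) + h s) s) {T : ℝ} (hT : 0 ≤ T)
    (hcross : ∀ S : Set C(I, ℝ), IsCompact S → ∀ ε : ℝ, 0 < ε → ∀ᶠ N in atTop,
      ∃ B : ℝ → C(I, ℝ) → State N → ℝ, (∀ s f, PolyGrowth (B s f)) ∧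
        (∀ f ∈ S, ∀ s ∈ Set.Icc 0 T, ∀ x,
          (crossTerm M p f x - densityFunctional (h s) f) ^ 2 ≤ B s f x) ∧
        ∀ f ∈ S, ∀ s ∈ Set.Icc 0 T, expect (P N) (X N) s (B s f) ≤ ε)
    {S : Set C(I, ℝ)} (hS : IsCompact S) {ε : ℝ} (hε : 0 < ε) :
    ∀ᶠ N in atTop, ∀ f ∈ S, ∀ t ∈ Set.Icc 0 T,
      expect (P N) (X N) t (fun x => (powEmp p f x - densityFunctional (r t) f) ^ 2) ≤ ε := by
  obtain ⟨K, hK⟩ := M.exists_boundedBy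
  have hK0 : 0 ≤ K := zero_le_one.trans hK.one_le
  -- All backward test functions, for every t ≤ T and every g in `S`, lie in this one compact set;
  -- hence the threshold on N depends on neither.
  have hS' : IsCompact ((fun z : ℝ × C(I, ℝ) => opExp (z.1 • driftOp M p) z.2) ''
      (Set.Icc 0 T ×ˢ S)) :=
    (isCompact_Icc.prod hS).image (continuous_opExp_apply _)
  set S' := (fun z : ℝ × C(I, ℝ) => opExp (z.1 • driftOp M p) z.2) '' (Set.Icc 0 T ×ˢ S)
    with hS'_def
  obtain ⟨R, hR, hSR⟩ := exists_pos_norm_bound hS'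
  set Q := Real.exp (6 * K * (2 * K) ^ (p * 2) * T) with hQ
  have hQ0 : 0 < Q := Real.exp_pos _
  -- The Gronwall bound below is exp(T)(δ + (3Q + 2)δT). The cap at 1 gives δ² ≤ δ.
  set δ := min 1 (ε / (Real.exp T * (1 + (3 * Q + 2) * T))) with hδ
  have hδ0 : 0 < δ := lt_min zero_lt_one (by positivity)
  have hδ1 : δ ≤ 1 := min_le_left _ _
  have hδε : Real.exp T * (δ + (3 * Q + 2) * δ * T) ≤ ε := by
    have := min_le_right 1 (ε / (Real.exp T * (1 + (3 * Q + 2) * T)))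
    rw [← hδ, le_div_iff₀ (by positivity)] at this
    linarith
  filter_upwards [gen_powEmp_approx M p hS' hδ0, hcross S' hS' δ hδ0,
    eventually_div_le (24 * K * (2 * K) ^ p * (2 * K) ^ p * R ^ 2) hδ0,
    initial_lln P (fun N => X N 0) (fun N hN => (hX N hN).measurable 0) hX₀ hp hS' hδ0,
    eventually_ge_atTop 1] with N hgen hB hD hinit hN g hg t ht
  obtain ⟨B, hBg, hBle, hBε⟩ := hB
  have hXN := hX N hN
  have h0 := (hX₀ N hN).ae_zero_or_one (hXN.measurable 0)
  set D := 24 * K * (2 * K) ^ p * (2 * K) ^ p * R ^ 2 with hD_def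
  have hD0 : 0 ≤ D := by positivity
  set f : ℝ → C(I, ℝ) := fun s => opExp ((t - s) • driftOp M p) g with hf_def
  have hfS : ∀ s ∈ Set.Icc 0 t, f s ∈ S' := fun s hs =>
    ⟨(t - s, g), ⟨⟨by linarith [hs.2], by linarith [hs.1, ht.2]⟩, hg⟩, rfl⟩
  have hf : ∀ s, HasDerivAt f (-(driftOp M p (f s))) s := fun s =>
    hasDerivAt_opExp_backward _ g t s
  have hc : ∀ s, HasDerivAt (fun s => densityFunctional (r s) (f s))
      (densityFunctional (h s) (f s)) s := fun s => by
    have h1 := hasDerivAt_densityFunctional (hr s) (hf s)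
    have h2 : densityFunctional (driftOpDual M p (r s) + h s) (f s) +
        densityFunctional (r s) (-(driftOp M p (f s))) = densityFunctional (h s) (f s) := by
      rw [densityFunctional_add, add_apply, map_neg, densityFunctional_driftOp]
      ring
    rwa [h2] at h1
  have hpow := polyGrowth_powEmp (N := N) (p := p * 2) (by omega) 1
  -- In `B`, the drift splits into the generator error and the interaction error, whose squares are
  -- doubled; D/N bounds the carré du champ. The expectation is at most (2δ² + δ)Q + 2δ ≤ (3Q + 2)δ.
  have key := powEmp_second_moment_le hXN h0 hp3 hf hc ht.1
    (by positivity : 0 ≤ (3 * Q + 2) * δ)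
    (B := fun s x => (2 * δ ^ 2 + D / N) * powEmp (p * 2) 1 x + 2 * B s (f s) x)
    (fun s => (hpow.const_mul _).add ((hBg s (f s)).const_mul 2)) ?_ ?_
  · have hft : f t = g := by
      simp only [hf_def, sub_self]
      exact opExp_zero_smul _ _
    simp only [hft] at key
    refine key.trans (le_trans ?_ hδε)
    have hexp0 : expect (P N) (X N) 0
        (fun x => (powEmp p (f 0) x - densityFunctional (r 0) (f 0)) ^ 2) ≤ δ := by
      rw [hr0, expect, Real.toNNReal_zero]
      exact hinit _ (hfS 0 ⟨le_rfl, ht.1⟩)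
    have hle : (3 * Q + 2) * δ * t ≤ (3 * Q + 2) * δ * T :=
      mul_le_mul_of_nonneg_left ht.2 (by positivity)
    exact (mul_le_mul_of_nonneg_left (add_le_add hexp0 hle) (Real.exp_pos _).le).trans
      (mul_le_mul_of_nonneg_right (Real.exp_le_exp.2 ht.2) (by positivity))
  · intro s hs x
    have hsS := hfS s ⟨hs.1.le, hs.2.le⟩
    have e1 := hgen (f s) hsS x
    have e2 := hBle (f s) hsS s ⟨hs.1.le, hs.2.le.trans ht.2⟩ x
    have e3 := gam_powEmp_le hK p (f s) (hSR _ hsS) x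
    rw [← hD_def] at e3
    have e4 := powEmp_one_pow_le p 1 x
    norm_num at e4
    set u := gen M (powEmp p (f s)) x - powEmp p (driftOp M p (f s)) x - crossTerm M p (f s) x
    have e5 : u ^ 2 ≤ δ ^ 2 * powEmp (p * 2) 1 x := by
      calc u ^ 2 = |u| ^ 2 := (sq_abs u).symm
        _ ≤ (δ * powEmp p 1 x) ^ 2 := by gcongr
        _ = δ ^ 2 * powEmp p 1 x ^ 2 := mul_pow _ _ _
        _ ≤ _ := by gcongr
    have e6 : gen M (powEmp p (f s)) x - powEmp p (driftOp M p (f s)) x -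
        densityFunctional (h s) (f s) =
        u + (crossTerm M p (f s) x - densityFunctional (h s) (f s)) := by ring
    rw [e6]
    nlinarith [sq_nonneg (u - (crossTerm M p (f s) x - densityFunctional (h s) (f s)))]
  · intro s hs
    have hsS := hfS s ⟨hs.1.le, hs.2.le⟩
    rw [expect_add hXN h0 (hpow.const_mul _) ((hBg s (f s)).const_mul 2), expect_const_mul,
      expect_const_mul]
    have e1 := hBε (f s) hsS s ⟨hs.1.le, hs.2.le.trans ht.2⟩
    have e2 : expect (P N) (X N) s (powEmp (p * 2) 1) ≤ Q := by
      refine (expect_powEmp_one_le hK hXN h0 (p * 2) hs.1.le).trans ?_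
      have := hs.2.le.trans ht.2
      rw [hQ]
      gcongr
    have e3 : 2 * δ ^ 2 + D / N ≤ 3 * δ := by nlinarith
    have e4 : (2 * δ ^ 2 + D / N) * expect (P N) (X N) s (powEmp (p * 2) 1) ≤ 3 * δ * Q := by
      calc _ ≤ (2 * δ ^ 2 + D / N) * Q := by gcongr
        _ ≤ _ := by gcongr
    linarith

theorem crossTerm_one (M : Coeffs) {N : ℕ} (f : C(I, ℝ)) (x : State N) :
    crossTerm M 1 f x = 0 := by
  simp [crossTerm]

/-- The first-order empirical measure converges to the hydrodynamic density. -/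
theorem powEmp_one_lln (hX : ∀ N, 1 ≤ N → IsLinearSystem M N (P N) (X N))
    (hX₀ : ∀ N, 1 ≤ N → IsInitialState φ N (P N) (X N 0))
    {ρ : ℝ → C(I, ℝ)} (hρ0 : ρ 0 = φ) (hρ : ∀ s, HasDerivAt ρ (hydroOp M (ρ s)) s)
    {T : ℝ} (hT : 0 ≤ T) {S : Set C(I, ℝ)} (hS : IsCompact S) {ε : ℝ} (hε : 0 < ε) :
    ∀ᶠ N in atTop, ∀ f ∈ S, ∀ t ∈ Set.Icc 0 T,
      expect (P N) (X N) t (fun x => (powEmp 1 f x - densityFunctional (ρ t) f) ^ 2) ≤ ε := by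
  refine powEmp_lln hX hX₀ (h := fun _ => 0) one_ne_zero (by norm_num) hρ0
    (fun s => by simpa [driftOpDual_one] using hρ s) hT
    (fun S _ ε hε => Eventually.of_forall fun N => ⟨fun _ _ _ => 0, fun _ _ => PolyGrowth.const 0,
      fun f _ s _ x => ?_, fun f _ s _ => ?_⟩) hS hε
  · simp [crossTerm_one, densityFunctional_apply]
  · rw [expect_const]; exact hε.le

/-- The mixed parts are 2a₁a₂x(i)x(j) and 2a₃a₄x(i)x(j); relabelling the second puts both test
functions at i. For fixed i, the sum over j is then a first-order empirical average of the kernel,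
and the last term removes the diagonal. -/
theorem crossTerm_two (M : Coeffs) {N : ℕ} (f : C(I, ℝ)) (x : State N) :
    crossTerm M 2 f x =
      2 * ((1 / N : ℝ) * ∑ i, (x i : ℝ) *
        (f (pos i) * powEmp 1 ((crossKer M).curry (pos i)) x)) -
      2 / N * ((1 / N : ℝ) * ∑ i, (x i : ℝ) ^ 2 * (f (pos i) * crossKer M (pos i, pos i))) := by
  have hk : ∀ u v, crossKer M (u, v) = M.a₁ (u, v) * M.a₂ (u, v) * M.lam (u, v) +
      M.lam (v, u) * M.a₃ (v, u) * M.a₄ (v, u) := fun u v => by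
    simp [crossKer, swapK, toR]
  have e : ∑ i : Fin N, ∑ j : Fin N, (M.lam (pos i, pos j) : ℝ) *
      (f (pos i) * ((M.a₁ (pos i, pos j) * x i + M.a₂ (pos i, pos j) * x j) ^ 2 -
        (M.a₁ (pos i, pos j) : ℝ) ^ 2 * (x i : ℝ) ^ 2 -
        (M.a₂ (pos i, pos j) : ℝ) ^ 2 * (x j : ℝ) ^ 2) +
      f (pos j) * ((M.a₃ (pos i, pos j) * x i + M.a₄ (pos i, pos j) * x j) ^ 2 -
        (M.a₃ (pos i, pos j) : ℝ) ^ 2 * (x i : ℝ) ^ 2 -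
        (M.a₄ (pos i, pos j) : ℝ) ^ 2 * (x j : ℝ) ^ 2)) =
      ∑ i : Fin N, ∑ j : Fin N, 2 * ((x i : ℝ) * (f (pos i) *
        ((x j : ℝ) * crossKer M (pos i, pos j)))) := by
    have hswap := Finset.sum_comm (s := (Finset.univ : Finset (Fin N)))
      (t := (Finset.univ : Finset (Fin N)))
      (f := fun i j => 2 * ((x j : ℝ) * (f (pos j) * ((x i : ℝ) *
        (M.lam (pos i, pos j) * M.a₃ (pos i, pos j) * M.a₄ (pos i, pos j))))))
    have hr : ∀ i j : Fin N, 2 * ((x i : ℝ) * (f (pos i) *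
        ((x j : ℝ) * crossKer M (pos i, pos j)))) =
        2 * ((x i : ℝ) * (f (pos i) * ((x j : ℝ) *
          (M.a₁ (pos i, pos j) * M.a₂ (pos i, pos j) * M.lam (pos i, pos j))))) +
        2 * ((x i : ℝ) * (f (pos i) * ((x j : ℝ) *
          (M.lam (pos j, pos i) * M.a₃ (pos j, pos i) * M.a₄ (pos j, pos i))))) := fun i j => by
      rw [hk]; ring
    simp_rw [hr, Finset.sum_add_distrib]
    rw [← hswap, ← Finset.sum_add_distrib]
    simp_rw [← Finset.sum_add_distrib]
    exact Finset.sum_congr rfl fun i _ => Finset.sum_congr rfl fun j _ => by ring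
  rw [crossTerm, sum_sum_ne, e]
  simp only [powEmp, pow_one, ContinuousMap.curry_apply, mul_sub, Finset.mul_sum, hk]
  congr 1
  · exact Finset.sum_congr rfl fun i _ => Finset.sum_congr rfl fun j _ => by ring
  · exact Finset.sum_congr rfl fun i _ => by ring

end Limit

/-! ### Limit of the quadratic interaction term -/

/-- A Young inequality for an unbounded weight x times a fluctuation d known to be small only in
second moment: sixth powers enter with an arbitrarily small factor ζ, at the price of a large
multiple of d². -/
theorem sq_mul_sq_le {x d ζ : ℝ} (hζ : 0 < ζ) :
    x ^ 2 * d ^ 2 ≤ ζ * (x ^ 6 + d ^ 6) + 1 / (4 * ζ) * d ^ 2 := by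
  have h1 : x ^ 2 ≤ ζ * x ^ 4 + 1 / (4 * ζ) := by
    have : ζ * x ^ 4 + 1 / (4 * ζ) - x ^ 2 = (2 * ζ * x ^ 2 - 1) ^ 2 / (4 * ζ) := by
      field_simp; ring
    have h2 : 0 ≤ (2 * ζ * x ^ 2 - 1) ^ 2 / (4 * ζ) := by positivity
    linarith
  have h3 : x ^ 4 * d ^ 2 ≤ x ^ 6 + d ^ 6 := by
    rcases le_total (x ^ 2) (d ^ 2) with h | h
    · calc x ^ 4 * d ^ 2 = (x ^ 2) ^ 2 * d ^ 2 := by ring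
        _ ≤ (d ^ 2) ^ 2 * d ^ 2 := by gcongr
        _ = d ^ 6 := by ring
        _ ≤ _ := le_add_of_nonneg_left (by positivity)
    · calc x ^ 4 * d ^ 2 ≤ x ^ 4 * x ^ 2 := by gcongr
        _ = x ^ 6 := by ring
        _ ≤ _ := le_add_of_nonneg_right (by positivity)
  calc x ^ 2 * d ^ 2 ≤ (ζ * x ^ 4 + 1 / (4 * ζ)) * d ^ 2 := by gcongr
    _ = ζ * (x ^ 4 * d ^ 2) + 1 / (4 * ζ) * d ^ 2 := by ring
    _ ≤ _ := by gcongr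

theorem sq_average_le {N : ℕ} (a : Fin N → ℝ) :
    ((1 / N : ℝ) * ∑ i, a i) ^ 2 ≤ (1 / N : ℝ) * ∑ i, a i ^ 2 := by
  rcases Nat.eq_zero_or_pos N with rfl | hN
  · simp
  have hN' : (0 : ℝ) < N := by exact_mod_cast hN
  have := sq_sum_le_card_mul_sum_sq (s := Finset.univ) (f := a)
  simp only [Finset.card_univ, Fintype.card_fin] at this
  calc ((1 / N : ℝ) * ∑ i, a i) ^ 2 = (1 / N : ℝ) ^ 2 * (∑ i, a i) ^ 2 := mul_pow _ _ _
    _ ≤ (1 / N : ℝ) ^ 2 * (N * ∑ i, a i ^ 2) := by gcongr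
    _ = _ := by field_simp

/-- The contribution of the weighted fluctuations `d i` is controlled by sixth moments and by the
unweighted second moments of the fluctuations. -/
theorem sq_weighted_average_le {N : ℕ} (x : State N) {w d : Fin N → ℝ} {R L ζ : ℝ}
    (hζ : 0 < ζ) (hw : ∀ i, |w i| ≤ R) (hd : ∀ i, |d i| ≤ L * (powEmp 1 1 x + 1)) :
    ((1 / N : ℝ) * ∑ i, (x i : ℝ) * (w i * d i)) ^ 2 ≤
      R ^ 2 * (ζ * (1 + 32 * L ^ 6) * powEmp 6 1 x + 32 * ζ * L ^ 6 +
        1 / (4 * ζ) * ((1 / N : ℝ) * ∑ i, d i ^ 2)) := by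
  -- The 32 = 2^5 comes from (a + b)^6 ≤ 2^5 (a^6 + b^6), followed by the power mean inequality.
  have hpow : ∀ i, d i ^ 6 ≤ 32 * L ^ 6 * (powEmp 6 1 x + 1) := by
    intro i
    have h1 := powEmp_one_nonneg 1 x
    calc d i ^ 6 = |d i| ^ 6 := (Even.pow_abs (by decide) _).symm
      _ ≤ (L * (powEmp 1 1 x + 1)) ^ 6 := pow_le_pow_left₀ (abs_nonneg _) (hd i) 6
      _ = L ^ 6 * (powEmp 1 1 x + 1) ^ 6 := mul_pow _ _ _
      _ ≤ L ^ 6 * (2 ^ (6 - 1) * (powEmp 1 1 x ^ 6 + 1 ^ 6)) := by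
          gcongr
          exact add_pow_le h1 zero_le_one 6
      _ ≤ L ^ 6 * (2 ^ (6 - 1) * (powEmp 6 1 x + 1 ^ 6)) := by
          gcongr
          exact powEmp_one_pow_le 1 5 x
      _ = _ := by norm_num; ring
  refine (sq_average_le _).trans ?_
  calc (1 / N : ℝ) * ∑ i, ((x i : ℝ) * (w i * d i)) ^ 2
      ≤ (1 / N : ℝ) * ∑ i, (R ^ 2 * (ζ * (x i : ℝ) ^ 6 + 1 / (4 * ζ) * d i ^ 2) +
          R ^ 2 * (ζ * (32 * L ^ 6 * (powEmp 6 1 x + 1)))) := by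
        gcongr with i
        have h1 : w i ^ 2 ≤ R ^ 2 := by
          rw [← sq_abs]; exact pow_le_pow_left₀ (abs_nonneg _) (hw i) 2
        have h2 := sq_mul_sq_le (x := (x i : ℝ)) (d := d i) hζ
        calc ((x i : ℝ) * (w i * d i)) ^ 2 = w i ^ 2 * ((x i : ℝ) ^ 2 * d i ^ 2) := by ring
          _ ≤ R ^ 2 * (ζ * ((x i : ℝ) ^ 6 + 32 * L ^ 6 * (powEmp 6 1 x + 1)) +
              1 / (4 * ζ) * d i ^ 2) := by
            gcongr
            exact h2.trans (by gcongr; exact hpow i)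
          _ = _ := by ring
    _ = R ^ 2 * (ζ * powEmp 6 1 x + 1 / (4 * ζ) * ((1 / N : ℝ) * ∑ i, d i ^ 2)) +
        (1 / N : ℝ) * ∑ _i : Fin N, R ^ 2 * (ζ * (32 * L ^ 6 * (powEmp 6 1 x + 1))) := by
        rw [Finset.sum_add_distrib, ← Finset.mul_sum, Finset.sum_add_distrib, ← Finset.mul_sum,
          ← Finset.mul_sum, powEmp_one_eq]
        ring
    _ ≤ R ^ 2 * (ζ * powEmp 6 1 x + 1 / (4 * ζ) * ((1 / N : ℝ) * ∑ i, d i ^ 2)) +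
        R ^ 2 * (ζ * (32 * L ^ 6 * (powEmp 6 1 x + 1))) := by
        have h1 := powEmp_one_nonneg 6 x
        exact add_le_add le_rfl (average_le (by positivity) fun i => le_rfl)
    _ = _ := by ring

/-- The pathwise bound on the deviation of the interaction term from its limit. -/
theorem sq_crossTerm_sub_le (M : Coeffs) {N : ℕ} (hN : 1 ≤ N) (f ρ : C(I, ℝ)) {R W ζ : ℝ}
    (hζ : 0 < ζ) (hf : ‖f‖ ≤ R) (hρ : ‖ρ‖ ≤ W) (x : State N) :
    (crossTerm M 2 f x - densityFunctional ((2 : ℝ) • (ρ * kernelOp (crossKer M) ρ)) f) ^ 2 ≤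
      12 * R ^ 2 * (ζ * (1 + 32 * (‖crossKer M‖ * (1 + W)) ^ 6) * powEmp 6 1 x +
        32 * ζ * (‖crossKer M‖ * (1 + W)) ^ 6 + 1 / (4 * ζ) * ((1 / N : ℝ) * ∑ i : Fin N,
          (powEmp 1 ((crossKer M).curry (pos i)) x -
            densityFunctional ρ ((crossKer M).curry (pos i))) ^ 2)) +
      12 * (powEmp 1 (f * kernelOp (crossKer M) ρ) x -
        densityFunctional ρ (f * kernelOp (crossKer M) ρ)) ^ 2 +
      12 * (R * ‖crossKer M‖) ^ 2 / N * powEmp 4 1 x := by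
  have hR : 0 ≤ R := (norm_nonneg f).trans hf
  have hW : 0 ≤ W := (norm_nonneg ρ).trans hρ
  have hfR : ∀ u, |f u| ≤ R := fun u => (f.norm_coe_le_norm u).trans hf
  set κ := crossKer M with hκ
  have hκu : ∀ u, ‖κ.curry u‖ ≤ ‖κ‖ := fun u =>
    (ContinuousMap.norm_le _ (norm_nonneg κ)).2 fun v => κ.norm_coe_le_norm (u, v)
  set d : Fin N → ℝ := fun i =>
    powEmp 1 (κ.curry (pos i)) x - densityFunctional ρ (κ.curry (pos i)) with hd_def
  have hd : ∀ i, |d i| ≤ ‖κ‖ * (1 + W) * (powEmp 1 1 x + 1) := by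
    intro i
    have h1 := abs_powEmp_le 1 (κ.curry (pos i)) x
    have h2 := abs_densityFunctional_le ρ (κ.curry (pos i))
    have h3 := powEmp_one_nonneg 1 x
    calc |d i| ≤ _ := abs_sub _ _
      _ ≤ ‖κ.curry (pos i)‖ * powEmp 1 1 x + ‖ρ‖ * ‖κ.curry (pos i)‖ := add_le_add h1 h2
      _ ≤ ‖κ‖ * powEmp 1 1 x + W * ‖κ‖ := by gcongr <;> exact hκu _
      _ ≤ _ := by
        have : 0 ≤ ‖κ‖ * W * powEmp 1 1 x := by positivity
        nlinarith [norm_nonneg κ]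
  have hdens : ∀ u, densityFunctional ρ (κ.curry u) = kernelOp κ ρ u := fun u => by
    rw [densityFunctional_apply, kernelOp_apply]
    simp only [ContinuousMap.curry_apply, mul_comm]
  have hlim : densityFunctional ((2 : ℝ) • (ρ * kernelOp κ ρ)) f =
      2 * densityFunctional ρ (f * kernelOp κ ρ) := by
    rw [densityFunctional_apply, densityFunctional_apply, ← integral_const_mul]
    refine integral_congr_ae (Eventually.of_forall fun u => ?_)
    simp only [ContinuousMap.smul_apply, ContinuousMap.mul_apply, smul_eq_mul]
    ring
  -- Here `a` is the error from replacing the inner averages by their limits, `b` the fluctuation of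
  -- the remaining outer average, and `e` the diagonal.
  set a := (1 / N : ℝ) * ∑ i, (x i : ℝ) * (f (pos i) * d i) with ha
  set b := powEmp 1 (f * kernelOp κ ρ) x - densityFunctional ρ (f * kernelOp κ ρ) with hb
  set e := (1 / N : ℝ) * ∑ i, (x i : ℝ) ^ 2 * (f (pos i) * κ (pos i, pos i)) with he
  have hdecomp : crossTerm M 2 f x - densityFunctional ((2 : ℝ) • (ρ * kernelOp κ ρ)) f =
      2 * a + 2 * b - 2 / N * e := by
    have h1 : (1 / N : ℝ) * ∑ i, (x i : ℝ) * (f (pos i) * powEmp 1 (κ.curry (pos i)) x) =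
        a + powEmp 1 (f * kernelOp κ ρ) x := by
      rw [ha, powEmp, ← mul_add, ← Finset.sum_add_distrib]
      congr 1
      refine Finset.sum_congr rfl fun i _ => ?_
      rw [hd_def, ContinuousMap.mul_apply, ← hdens]
      ring
    rw [crossTerm_two, hlim, ← hκ, h1]
    ring
  have h1 : a ^ 2 ≤ _ := sq_weighted_average_le x hζ (fun i => hfR (pos i)) hd
  have h2 : (2 / N * e) ^ 2 ≤ 4 * (R * ‖κ‖) ^ 2 / N * powEmp 4 1 x := by
    have h3 : |e| ≤ R * ‖κ‖ * powEmp 2 1 x := abs_weighted_powEmp_le 2 (fun i => by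
      rw [abs_mul]
      exact mul_le_mul (hfR _) (κ.norm_coe_le_norm _) (abs_nonneg _) hR) x
    have h4 : e ^ 2 ≤ (R * ‖κ‖) ^ 2 * powEmp 4 1 x := by
      calc e ^ 2 = |e| ^ 2 := (sq_abs e).symm
        _ ≤ (R * ‖κ‖ * powEmp 2 1 x) ^ 2 := by gcongr
        _ = (R * ‖κ‖) ^ 2 * powEmp 2 1 x ^ 2 := mul_pow _ _ _
        _ ≤ _ := by gcongr; exact powEmp_one_pow_le 2 1 x
    have hN' : (1 : ℝ) ≤ N := by exact_mod_cast hN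
    have h5 : (2 / N : ℝ) ^ 2 ≤ 4 / N := by
      rw [div_pow, div_le_div_iff₀ (by positivity) (by positivity)]
      nlinarith
    calc (2 / N * e) ^ 2 = (2 / N : ℝ) ^ 2 * e ^ 2 := mul_pow _ _ _
      _ ≤ 4 / N * ((R * ‖κ‖) ^ 2 * powEmp 4 1 x) := by gcongr
      _ = _ := by ring
  rw [hdecomp]
  -- This is (p + q - r)² ≤ 3(p² + q² + r²) with p = 2a and q = 2b.
  calc (2 * a + 2 * b - 2 / N * e) ^ 2 ≤ 12 * a ^ 2 + 12 * b ^ 2 + 3 * (2 / N * e) ^ 2 := by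
        nlinarith [sq_nonneg (2 * a - 2 * b), sq_nonneg (2 * a + 2 / N * e),
          sq_nonneg (2 * b + 2 / N * e)]
    _ ≤ _ := by
        refine (add_le_add (add_le_add (mul_le_mul_of_nonneg_left h1 (by norm_num)) le_rfl)
          (mul_le_mul_of_nonneg_left h2 (by norm_num))).trans (le_of_eq ?_)
        ring

section Limit

variable {M : Coeffs} {φ : C(I, ℝ)} {Ω : ℕ → Type*} [∀ N, MeasurableSpace (Ω N)]
  {P : ∀ N, Measure (Ω N)} [∀ N, IsProbabilityMeasure (P N)] {X : ∀ N, ℝ≥0 → Ω N → State N}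

/-- Provides the hypothesis on the interaction that `powEmp_lln` requires for p = 2, by feeding the
first-order law of large numbers into the pathwise bound. -/
theorem crossTerm_two_limit (hX : ∀ N, 1 ≤ N → IsLinearSystem M N (P N) (X N))
    (hX₀ : ∀ N, 1 ≤ N → IsInitialState φ N (P N) (X N 0))
    {ρ : ℝ → C(I, ℝ)} (hρ0 : ρ 0 = φ) (hρ : ∀ s, HasDerivAt ρ (hydroOp M (ρ s)) s)
    {T : ℝ} (hT : 0 ≤ T) {S : Set C(I, ℝ)} (hS : IsCompact S) {ε : ℝ} (hε : 0 < ε) :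
    ∀ᶠ N in atTop, ∃ B : ℝ → C(I, ℝ) → State N → ℝ, (∀ s f, PolyGrowth (B s f)) ∧
      (∀ f ∈ S, ∀ s ∈ Set.Icc 0 T, ∀ x,
        (crossTerm M 2 f x -
          densityFunctional ((2 : ℝ) • (ρ s * kernelOp (crossKer M) (ρ s))) f) ^ 2 ≤ B s f x) ∧
      ∀ f ∈ S, ∀ s ∈ Set.Icc 0 T, expect (P N) (X N) s (B s f) ≤ ε := by
  obtain ⟨K, hK⟩ := M.exists_boundedBy
  have hK0 : 0 ≤ K := zero_le_one.trans hK.one_le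
  obtain ⟨R, hR, hSR⟩ := exists_pos_norm_bound hS
  have hρc : Continuous ρ := continuous_iff_continuousAt.2 fun s => (hρ s).continuousAt
  obtain ⟨W, hW, hρW⟩ := exists_pos_norm_bound (isCompact_Icc.image hρc : IsCompact
    (ρ '' Set.Icc 0 T))
  set κ := crossKer M with hκ
  -- These are the test functions needed at first order: the slices κ(u, ·) for the inner averages,
  -- and f · κρ_s for the outer one.
  have hS₁ : IsCompact (Set.range κ.curry ∪
      (fun z : ℝ × C(I, ℝ) => z.2 * kernelOp κ (ρ z.1)) '' (Set.Icc 0 T ×ˢ S)) :=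
    (isCompact_range κ.curry.continuous).union ((isCompact_Icc.prod hS).image (by fun_prop))
  set L := ‖κ‖ * (1 + W) with hL_def
  have hL : 0 ≤ L := by positivity
  set Q := Real.exp (6 * K * (2 * K) ^ 6 * T) with hQ
  set Q₄ := Real.exp (6 * K * (2 * K) ^ 4 * T) with hQ₄
  have hQ0 : 0 < Q := Real.exp_pos _
  have hQ₄0 : 0 < Q₄ := Real.exp_pos _
  set A := (1 + 32 * L ^ 6) * Q + 32 * L ^ 6 with hA
  have hA0 : 0 < A := by positivity
  -- The choices are made in order, each worth ε/3: ζ absorbs the sixth moments, then δ, depending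
  -- on ζ, the first-order fluctuations, and finally N the diagonal.
  set ζ := ε / (3 * (12 * R ^ 2 * A)) with hζ_def
  have hζ : 0 < ζ := by positivity
  set δ := ε / (3 * (12 * R ^ 2 * (1 / (4 * ζ)) + 12)) with hδ_def
  have hδ : 0 < δ := by positivity
  filter_upwards [powEmp_one_lln hX hX₀ hρ0 hρ hT hS₁ hδ,
    eventually_div_le (12 * (R * ‖κ‖) ^ 2) (by positivity : 0 < ε / (3 * Q₄)),
    eventually_ge_atTop 1] with N h1 h2 hN
  have hXN := hX N hN
  have h0 := (hX₀ N hN).ae_zero_or_one (hXN.measurable 0)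
  have hp6 := polyGrowth_powEmp (N := N) (p := 6) le_rfl 1
  have hp4 := polyGrowth_powEmp (N := N) (p := 4) (by norm_num) 1
  have hpd := fun (s : ℝ) (f : C(I, ℝ)) =>
    polyGrowth_powEmp_sub_sq (N := N) (p := 1) (by norm_num) f (densityFunctional (ρ s) f)
  have hps := fun s => PolyGrowth.sum Finset.univ fun (i : Fin N) _ => hpd s (κ.curry (pos i))
  have g1 := fun s => ((((hp6.const_mul (ζ * (1 + 32 * L ^ 6))).add
    (PolyGrowth.const (32 * ζ * L ^ 6))).add
      (((hps s).const_mul (1 / N : ℝ)).const_mul (1 / (4 * ζ)))).const_mul (12 * R ^ 2))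
  have g2 := fun s f => (hpd s (f * kernelOp κ (ρ s))).const_mul 12
  have g3 := hp4.const_mul (12 * (R * ‖κ‖) ^ 2 / N)
  refine ⟨fun s f x => 12 * R ^ 2 * (ζ * (1 + 32 * L ^ 6) * powEmp 6 1 x + 32 * ζ * L ^ 6 +
      1 / (4 * ζ) * ((1 / N : ℝ) * ∑ i : Fin N, (powEmp 1 (κ.curry (pos i)) x -
        densityFunctional (ρ s) (κ.curry (pos i))) ^ 2)) +
      12 * (powEmp 1 (f * kernelOp κ (ρ s)) x -
        densityFunctional (ρ s) (f * kernelOp κ (ρ s))) ^ 2 +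
      12 * (R * ‖κ‖) ^ 2 / N * powEmp 4 1 x, fun s f => ((g1 s).add (g2 s f)).add g3,
    fun f hf s hs x => sq_crossTerm_sub_le M hN f (ρ s) hζ (hSR f hf) (hρW _ ⟨s, hs, rfl⟩) x,
    fun f hf s hs => ?_⟩
  have hexpT : ∀ q : ℕ, expect (P N) (X N) s (powEmp q 1) ≤
      Real.exp (6 * K * (2 * K) ^ q * T) := fun q => by
    refine (expect_powEmp_one_le hK hXN h0 q hs.1).trans ?_
    have := hs.2
    gcongr
  have e6 : expect (P N) (X N) s (powEmp 6 1) ≤ Q := hexpT 6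
  have e4 : expect (P N) (X N) s (powEmp 4 1) ≤ Q₄ := hexpT 4
  have ed : ∀ i : Fin N, expect (P N) (X N) s (fun x => (powEmp 1 (κ.curry (pos i)) x -
      densityFunctional (ρ s) (κ.curry (pos i))) ^ 2) ≤ δ := fun i =>
    h1 _ (Or.inl ⟨pos i, rfl⟩) s hs
  have ef := h1 _ (Or.inr ⟨(s, f), ⟨hs, hf⟩, rfl⟩) s hs
  have es : expect (P N) (X N) s (fun x => (1 / N : ℝ) * ∑ i : Fin N,
      (powEmp 1 (κ.curry (pos i)) x - densityFunctional (ρ s) (κ.curry (pos i))) ^ 2) ≤ δ := by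
    rw [expect_const_mul]
    unfold expect
    rw [integral_finsetSum _ fun i _ => (hpd s (κ.curry (pos i))).integrable hXN h0 s]
    exact average_le hδ.le ed
  rw [expect_add hXN h0 ((g1 s).add (g2 s f)) g3, expect_add hXN h0 (g1 s) (g2 s f),
    expect_const_mul, expect_const_mul, expect_const_mul,
    expect_add hXN h0 ((hp6.const_mul _).add (PolyGrowth.const _))
      (((hps s).const_mul _).const_mul _),
    expect_add hXN h0 (hp6.const_mul _) (PolyGrowth.const _), expect_const_mul, expect_const_mul,
    expect_const_mul, expect_const]
  have b1 : 12 * R ^ 2 * (ζ * A) = ε / 3 := by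
    rw [hζ_def]; field_simp
  have b2 : 12 * R ^ 2 * (1 / (4 * ζ) * δ) + 12 * δ = ε / 3 := by
    rw [hδ_def]; field_simp
  have b3 : 12 * (R * ‖κ‖) ^ 2 / N * Q₄ ≤ ε / 3 := by
    calc _ ≤ ε / (3 * Q₄) * Q₄ := by gcongr
      _ = ε / 3 := by field_simp
  calc _ ≤ 12 * R ^ 2 * (ζ * (1 + 32 * L ^ 6) * Q + 32 * ζ * L ^ 6 + 1 / (4 * ζ) * δ) + 12 * δ +
        12 * (R * ‖κ‖) ^ 2 / N * Q₄ := by gcongr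
    _ = 12 * R ^ 2 * (ζ * A) + (12 * R ^ 2 * (1 / (4 * ζ) * δ) + 12 * δ) +
        12 * (R * ‖κ‖) ^ 2 / N * Q₄ := by rw [hA]; ring
    _ ≤ ε := by rw [b1, b2]; linarith

end Limit

/-! ### The limiting equations -/

theorem exists_hydroDensity (M : Coeffs) (φ : C(I, ℝ)) :
    ∃ ρ : ℝ → C(I, ℝ), ρ 0 = φ ∧ ∀ t, HasDerivAt ρ (hydroOp M (ρ t)) t :=
  ⟨fun t => opExp (t • hydroOp M) φ, opExp_zero_smul _ _, fun t => hasDerivAt_opExp_apply' _ _ t⟩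

theorem IsHydroDensity.eqOn {M : Coeffs} {φ : C(I, ℝ)} {ρ ρ' : ℝ → C(I, ℝ)}
    (h : IsHydroDensity M φ ρ) (h' : IsHydroDensity M φ ρ') : Set.EqOn ρ' ρ (Set.Ici 0) := by
  intro t ht
  have hc : ∀ {τ : ℝ → C(I, ℝ)}, IsHydroDensity M φ τ → ContinuousOn τ (Set.Icc 0 t) :=
    fun hτ s hs => ((hτ.2 s hs.1).continuousWithinAt).mono Set.Icc_subset_Ici_self
  have hd : ∀ {τ : ℝ → C(I, ℝ)}, IsHydroDensity M φ τ →
      ∀ s ∈ Set.Ico 0 t, HasDerivWithinAt τ (hydroOp M (τ s)) (Set.Ici s) s :=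
    fun hτ s hs => (hτ.2 s hs.1).mono (Set.Ici_subset_Ici.2 hs.1)
  exact ODE_solution_unique (v := fun _ => hydroOp M) (fun _ => (hydroOp M).lipschitz) (hc h')
    (hd h') (hc h) (hd h) (h'.1.trans h.1.symm) (Set.right_mem_Icc.2 ht)

/-- The map `g ↦ g(u) du` as a bounded operator. -/
def densityCLM : C(I, ℝ) →L[ℝ] StrongDual ℝ C(I, ℝ) :=
  LinearMap.mkContinuous
    { toFun := densityFunctional
      map_add' := densityFunctional_add
      map_smul' := fun r g => by
        ext f
        simp [densityFunctional_apply, mul_assoc, integral_const_mul] } 1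
    (fun g => ContinuousLinearMap.opNorm_le_bound _ (by positivity) fun f => by
      rw [one_mul]
      exact abs_densityFunctional_le g f)

theorem densityCLM_apply (g : C(I, ℝ)) : densityCLM g = densityFunctional g := rfl

/-- The adjoint maps densities to densities, so the equation in the dual space can be solved inside
C[0,1]; this also yields the continuous density. -/
theorem adj_P₂_densityFunctional (M : Coeffs) (g : C(I, ℝ)) :
    adj (P₂ M) (densityFunctional g) = densityFunctional (driftOpDual M 2 g) := by
  ext f
  rw [← densityFunctional_driftOp, driftOp_two]
  rfl

/-- A solution of the equation for densities gives a solution of the equation for `θ`. -/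
theorem isThetaSolution_of_density {M : Coeffs} {φ : C(I, ℝ)} {ρ y : ℝ → C(I, ℝ)} (hy0 : y 0 = φ)
    (hy : ∀ t, HasDerivAt y
      (driftOpDual M 2 (y t) + (2 : ℝ) • (ρ t * kernelOp (crossKer M) (ρ t))) t) (T : ℝ) :
    IsThetaSolution M φ ρ T fun t => densityFunctional (y t) := by
  refine ⟨congrArg densityFunctional hy0, fun t _ => ?_⟩
  have h := HasFDerivAt.comp_hasDerivAt (E := StrongDual ℝ C(I, ℝ)) t densityCLM.hasFDerivAt (hy t)
  rw [map_add, map_smul] at h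
  simp only [densityCLM_apply] at h
  rw [← adj_P₂_densityFunctional, ← lOne_eq] at h
  exact h.hasDerivWithinAt

theorem IsThetaSolution.eqOn {M : Coeffs} {φ : C(I, ℝ)} {ρ : ℝ → C(I, ℝ)} {T : ℝ}
    {θ θ' : ℝ → StrongDual ℝ C(I, ℝ)} (h : IsThetaSolution M φ ρ T θ)
    (h' : IsThetaSolution M φ ρ T θ') : Set.EqOn θ' θ (Set.Icc 0 T) := by
  have hc : ∀ {τ : ℝ → StrongDual ℝ C(I, ℝ)}, IsThetaSolution M φ ρ T τ →
      ContinuousOn τ (Set.Icc 0 T) := fun hτ s hs =>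
    HasDerivWithinAt.continuousWithinAt (F := StrongDual ℝ C(I, ℝ)) (hτ.2 s hs)
  have hd : ∀ {τ : ℝ → StrongDual ℝ C(I, ℝ)}, IsThetaSolution M φ ρ T τ →
      ∀ s ∈ Set.Ico 0 T, HasDerivWithinAt τ (adj (P₂ M) (τ s) + lOne M (ρ s)) (Set.Ici s) s :=
    fun hτ s hs => HasDerivWithinAt.mono_of_mem_nhdsWithin (F := StrongDual ℝ C(I, ℝ))
      (hτ.2 s ⟨hs.1, hs.2.le⟩) (mem_of_superset (Icc_mem_nhdsGE hs.2)
        (Set.Icc_subset_Icc_left hs.1))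
  -- The source `lOne` is common to both solutions and cancels in differences, leaving the Lipschitz
  -- constant ‖P₂‖.
  refine ODE_solution_unique (E := StrongDual ℝ C(I, ℝ))
    (v := fun s τ => adj (P₂ M) τ + lOne M (ρ s)) (K := ‖P₂ M‖₊)
    (fun s => LipschitzWith.of_dist_le_mul fun τ τ' => ?_) (hc h') (hd h') (hc h) (hd h)
    (h'.1.trans h.1.symm)
  rw [dist_add_right, dist_eq_norm, dist_eq_norm, mul_comm]
  have e : adj (P₂ M) τ - adj (P₂ M) τ' = (τ - τ').comp (P₂ M) := rfl
  rw [e]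
  exact (τ - τ').opNorm_comp_le (P₂ M)

end NUrn

end

/-! ### The limit theorem -/

theorem lemma2p3 (M : NUrn.Coeffs) (φ : C(I, ℝ))
    {Ω : ℕ → Type*} [∀ N, MeasurableSpace (Ω N)] (P : ∀ N, Measure (Ω N))
    [∀ N, IsProbabilityMeasure (P N)] (X : ∀ N, ℝ≥0 → Ω N → NUrn.State N)
    (hX : ∀ N, 1 ≤ N → NUrn.IsLinearSystem M N (P N) (X N))
    (hX₀ : ∀ N, 1 ≤ N → NUrn.IsInitialState φ N (P N) (X N 0))
    (T : ℝ) (hT : 0 < T) :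
    -- the unique solution `ρ` of the hydrodynamic equation
    ∃ ρ : ℝ → C(I, ℝ), NUrn.IsHydroDensity M φ ρ ∧
      (∀ ρ', NUrn.IsHydroDensity M φ ρ' → Set.EqOn ρ' ρ (Set.Ici 0)) ∧
      -- the unique solution `θ` of the equation driven by `P₂^*` and `l_{1,t}`
      ∃ θ : ℝ → StrongDual ℝ C(I, ℝ), NUrn.IsThetaSolution M φ ρ T θ ∧
        (∀ θ', NUrn.IsThetaSolution M φ ρ T θ' → Set.EqOn θ' θ (Set.Icc 0 T)) ∧
        -- convergence in `L²`, uniformly in `t ∈ [0, T]`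
        (∀ H : C(Set.Icc (0 : ℝ) T × I, ℝ),
          Tendsto (fun N => ⨆ t : Set.Icc (0 : ℝ) T,
            ∫⁻ ω, ENNReal.ofReal
              ((NUrn.sqEmpirical (X N (Real.toNNReal t) ω) (H.curry t)
                - θ t (H.curry t)) ^ 2) ∂(P N)) atTop (𝓝 0)) ∧
        -- `θ_t` has a jointly continuous density
        ∃ ϑ : C(Set.Icc (0 : ℝ) T × I, ℝ),
          ∀ t : Set.Icc (0 : ℝ) T, θ t = NUrn.densityFunctional (ϑ.curry t) := by
  open NUrn in
  obtain ⟨ρ, hρ0, hρ⟩ := exists_hydroDensity M φ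
  have hρs : IsHydroDensity M φ ρ := ⟨hρ0, fun t _ => (hρ t).hasDerivWithinAt⟩
  have hρc : Continuous ρ := continuous_iff_continuousAt.2 fun s => (hρ s).continuousAt
  have hg : Continuous fun t => (2 : ℝ) • (ρ t * kernelOp (crossKer M) (ρ t)) := by fun_prop
  obtain ⟨y, hy0, hy⟩ := exists_inhomogeneous_solution (driftOpDual M 2) φ hg
  have hyc : Continuous y := continuous_iff_continuousAt.2 fun s => (hy s).continuousAt
  have hθ := isThetaSolution_of_density hy0 hy T
  refine ⟨ρ, hρs, fun ρ' h' => hρs.eqOn h', fun t => densityFunctional (y t), hθ,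
    fun θ' h' => hθ.eqOn h', fun H => ?_,
    ContinuousMap.uncurry ⟨fun t => y t, hyc.comp continuous_subtype_val⟩, fun t => rfl⟩
  rw [ENNReal.tendsto_nhds_zero]
  intro ε hε
  obtain ⟨δ, hδ, hδε⟩ : ∃ δ : ℝ, 0 < δ ∧ ENNReal.ofReal δ ≤ ε := by
    rcases eq_or_ne ε ⊤ with rfl | h
    · exact ⟨1, one_pos, le_top⟩
    · exact ⟨ε.toReal, ENNReal.toReal_pos hε.ne' h, ENNReal.ofReal_toReal_le⟩
  -- The slices H_t form a compact subset of C[0,1], being the continuous image of [0, T]; this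
  -- covers time-dependent test functions at no extra cost.
  have hlln := powEmp_lln hX hX₀ (p := 2) two_ne_zero (by norm_num) hy0 hy hT.le
    (fun S hS ε hε => crossTerm_two_limit hX hX₀ hρ0 hρ hT.le hS hε)
    (isCompact_range H.curry.continuous) hδ
  filter_upwards [hlln, eventually_ge_atTop 1] with N hN hN1
  refine iSup_le fun t => le_trans ?_ hδε
  have h1 := hN _ ⟨t, rfl⟩ t t.2
  have hint := (polyGrowth_powEmp_sub_sq (N := N) (p := 2) (by norm_num) (H.curry t)
    (densityFunctional (y t) (H.curry t))).integrable (hX N hN1)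
      ((hX₀ N hN1).ae_zero_or_one ((hX N hN1).measurable 0)) t
  simp_rw [sqEmpirical_apply]
  change ∫⁻ ω, ENNReal.ofReal ((powEmp 2 (H.curry t) (X N (Real.toNNReal t) ω) -
    densityFunctional (y t) (H.curry t)) ^ 2) ∂(P N) ≤ _
  rw [← ofReal_integral_eq_lintegral_ofReal hint (Eventually.of_forall fun ω => sq_nonneg _)]
  exact ENNReal.ofReal_le_ofReal h1
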